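/- Setting. There are $N$ clients with weights $p_n\ge 0$, $\sum_{n=1}^N p_n=1$; models are $w=[w_c;w_s]\in\mathbb R^{d_c}\times\mathbb R^{d_s}$ with the Euclidean norm. A mini-batch $\zeta_n$ of client $n$ has law $\mathcal D_n$, and the loss of $w$ on a mini-batch is $f(w;\zeta)=h(w_s;u(w_c;\zeta))$, differentiable in $w$. Put $f_n(w)=\mathbb E_{\zeta\sim\mathcal D_n}f(w;\zeta)$, $\nabla f_n(w)=\mathbb E_{\zeta\sim\mathcal D_n}\nabla f(w;\zeta)$, $F=\sum_n p_nf_n$, $\nabla F=\sum_n p_n\nabla f_n$ (these expectations exist), and let $w^*=[w_c^*;w_s^*]$ minimize $F$. MiniBatch-SFL. Let $T,E,M\ge1$ be integers. Start from a model $w^0=[w_c^0;w_s^0]$ (deterministic, or random, square integrable and independent of the mini-batches), with $w_{c,n}^0=w_c^0$ for all $n$. In step $i=1,\dots,TEM$ mini-batches $\zeta_n^{i-1}\sim\mathcal D_n$ are drawn, independently over all steps and clients, and $$w_s^i=w_s^{i-1}-\eta_s^{i-1}\frac{\sum_n p_n\nabla_{w_s}h\big(w_s^{i-1};u(w_{c,n}^{i-1};\zeta_n^{i-1})\big)}{\sum_n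 p_n},\qquad v_{c,n}^i=w_{c,n}^{i-1}-\eta_c^{i-1}\nabla_{w_c}h\big(w_s^{i-1};u(w_{c,n}^{i-1};\zeta_n^{i-1})\big);$$ then $w_{c,n}^i=\sum_m p_mv_{c,m}^i$ for all $n$ if $i\in\{tEM:1\le t\le T\}$, and $w_{c,n}^i=v_{c,n}^i$ otherwise. The output is $w^{TEM}=[w_c^{TEM};w_s^{TEM}]$ with $w_c^{TEM}=\sum_n p_nw_{c,n}^{TEM}$. Assumptions. Let $S,\mu>0$, let $R,\delta,\sigma_1,\dots,\sigma_N$ be constants, and let $W\subseteq\mathbb R^{d_c}\times\mathbb R^{d_s}$ be a set that almost surely contains all the models $[w_{c,n}^i;w_s^i]$, $0\le i<TEM$, $1\le n\le N$, at which the algorithm evaluates gradients. For every client $n$: (1) ($S$-smoothness) $f_n(y)\le f_n(x)+\langle\nabla f_n(x),y-x\rangle+\frac S2\|y-x\|^2$ for all $x,y$; (2) ($\mu$-strong convexity) $f_n(y)\ge f_n(x)+\langle\nabla f_n(x),y-x\rangle+\frac\mu2\|y-x\|^2$ for all $x,y$; (3) $\mathbb E_{\zeta\sim\mathcal D_n}\|\nabla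 f(w;\zeta)-\nabla f_n(w)\|^2\le\sigma_n^2$ for all $w\in W$; (4) $\mathbb E_{\zeta\sim\mathcal D_n}\|\nabla f(w;\zeta)\|^2\le R^2$ for all $w\in W$; (5) $\|\nabla f_n(w)-\nabla F(w)\|^2\le\delta^2$ for all $w\in W$. Theorem. Let $\gamma=\max\{8S/\mu-1,\,EM\}$ and $\eta_c^i=\eta_s^i=\frac{2}{\mu(\gamma+i)}$. Then $$\mathbb E[F(w^{TEM})]-F(w^*)\le\frac{S(L_s+L_c)}2,$$ where $$L_s=\frac{8R^2+\mu^2N^2(\gamma+1)\,\mathbb E\|w_s^0-w_s^*\|^2}{\mu^2N^2(\gamma+TEM)},\qquad L_c=\frac{4H+\mu^2(\gamma+1)\,\mathbb E\|w_c^0-w_c^*\|^2}{\mu^2(\gamma+TEM)},$$ $$H=6EMR^2+12E^2M^2\delta^2+6S\Gamma+\sum_n p_n^2\sigma_n^2,\qquad \Gamma=F(w^*)-\sum_n p_nf_n(w_{c,n}^*,w_s^*),$$ and $w_{c,n}^*$ is a minimizer of $w_c\mapsto f_n(w_c,w_s^*)$. In particular the bound equals $C/(\gamma+TEM)$ with $$C=\frac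 S2\Big(\frac{8R^2}{\mu^2N^2}+\frac{4H}{\mu^2}+(\gamma+1)\big(\mathbb E\|w_s^0-w_s^*\|^2+\mathbb E\|w_c^0-w_c^*\|^2\big)\Big),$$ which does not involve $T$, so the rate is $O(1/(\gamma+TEM))$. -/

import Mathlib

open MeasureTheory ProbabilityTheory

noncomputable section

namespace MiniBatchSFL

/-- Client-side parameters `w_c`. -/
abbrev ClientModel (dc : ℕ) : Type := EuclideanSpace ℝ (Fin dc)

/-- Server-side parameters `w_s`. -/
abbrev ServerModel (ds : ℕ) : Type := EuclideanSpace ℝ (Fin ds)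

/-- Full models `w = [w_c; w_s]`, with the Euclidean norm
`‖w‖ ^ 2 = ‖w_c‖ ^ 2 + ‖w_s‖ ^ 2`. -/
abbrev Model (dc ds : ℕ) : Type := WithLp 2 (ClientModel dc × ServerModel ds)

/-- The full model `[c; s]`. -/
def join {dc ds : ℕ} (c : ClientModel dc) (s : ServerModel ds) : Model dc ds :=
  WithLp.toLp 2 (c, s)

section Losses

variable {dc ds N : ℕ} {Z A : Type*}

/-- The mini-batch loss `f(w; ζ) = h(w_s; u(w_c; ζ))`. The activation space `A` is arbitrary,
so that the smashed data `u(w_c; ζ)` may carry the labels of the mini-batch. -/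
def batchLoss (h : ServerModel ds → A → ℝ) (u : ClientModel dc → Z → A)
    (w : Model dc ds) (z : Z) : ℝ :=
  h w.snd (u w.fst z)

/-- The stochastic gradient `∇f(w; ζ)` with respect to the full model `w`. -/
def batchGrad (h : ServerModel ds → A → ℝ) (u : ClientModel dc → Z → A)
    (w : Model dc ds) (z : Z) : Model dc ds :=
  gradient (fun w' : Model dc ds => batchLoss h u w' z) w

/-- The expected loss `f_n(w)` of a client whose mini-batches have law `P`. -/
def clientLoss [MeasurableSpace Z] (h : ServerModel ds → A → ℝ) (u : ClientModel dc → Z → A)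
    (P : Measure Z) (w : Model dc ds) : ℝ :=
  ∫ z, batchLoss h u w z ∂P

/-- `∇f_n(w)`, by definition the expectation of the stochastic gradient. -/
def clientGrad [MeasurableSpace Z] (h : ServerModel ds → A → ℝ) (u : ClientModel dc → Z → A)
    (P : Measure Z) (w : Model dc ds) : Model dc ds :=
  ∫ z, batchGrad h u w z ∂P

/-- The global objective `F(w) = ∑ n, p_n f_n(w)`. -/
def globalLoss [MeasurableSpace Z] (h : ServerModel ds → A → ℝ) (u : ClientModel dc → Z → A)
    (P : Fin N → Measure Z) (p : Fin N → ℝ) (w : Model dc ds) : ℝ :=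
  ∑ n, p n * clientLoss h u (P n) w

/-- `∇F(w) = ∑ n, p_n ∇f_n(w)`. -/
def globalGrad [MeasurableSpace Z] (h : ServerModel ds → A → ℝ) (u : ClientModel dc → Z → A)
    (P : Fin N → Measure Z) (p : Fin N → ℝ) (w : Model dc ds) : Model dc ds :=
  ∑ n, p n • clientGrad h u (P n) w

end Losses

section Algorithm

variable {dc ds N : ℕ} {Z A : Type*}

/-- What the system stores after an SGD step: the local client-side models `w_{c,n}` of all
clients and the single server-side model `w_s`. -/
structure State (N dc ds : ℕ) where
  client : Fin N → ClientModel dc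
  server : ServerModel ds

/-- The model `[w_{c,n}; w_s]` on which client `n` and the main server compute. -/
def State.localModel (st : State N dc ds) (n : Fin N) : Model dc ds :=
  join (st.client n) st.server

/-- The global model `[∑ n, p_n w_{c,n}; w_s]`. -/
def State.globalModel (p : Fin N → ℝ) (st : State N dc ds) : Model dc ds :=
  join (∑ n, p n • st.client n) st.server

/-- The main server's update: one gradient step with the weighted average of the gradients of
`h(·; z_n)`, where `z_n = u(w_{c,n}; ζ_n)` is the smashed data of client `n`. -/
def serverUpdate (h : ServerModel ds → A → ℝ) (u : ClientModel dc → Z → A) (p : Fin N → ℝ)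
    (ηs : ℝ) (batch : Fin N → Z) (st : State N dc ds) : ServerModel ds :=
  st.server - ηs • ((∑ n, p n)⁻¹ •
    ∑ n, p n • gradient (fun s => h s (u (st.client n) (batch n))) st.server)

/-- The local update of client `n`, giving `v_{c,n}`: one gradient step on
`w_c ↦ h(w_s; u(w_c; ζ_n))`, with the server-side model from before the server's update. -/
def clientUpdate (h : ServerModel ds → A → ℝ) (u : ClientModel dc → Z → A)
    (ηc : ℝ) (batch : Fin N → Z) (st : State N dc ds) (n : Fin N) : ClientModel dc :=
  st.client n - ηc • gradient (fun c => h st.server (u c (batch n))) (st.client n)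

/-- The SGD steps after which the fed server aggregates: `{t E M | t = 1, …, T}`. -/
def syncSteps (T E M : ℕ) : Finset ℕ :=
  (Finset.Icc 1 T).image fun t => t * E * M

/-- The state after the `i`-th SGD step of MiniBatch-SFL with step sizes `ηc`, `ηs`, run from
`w0` on the mini-batches `batch i n` (the mini-batch `ζ_n^i` is used in SGD step `i + 1`). -/
def run (h : ServerModel ds → A → ℝ) (u : ClientModel dc → Z → A) (p : Fin N → ℝ)
    (T E M : ℕ) (ηc ηs : ℕ → ℝ) (w0 : Model dc ds) (batch : ℕ → Fin N → Z) :
    ℕ → State N dc ds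
  | 0 => ⟨fun _ => w0.fst, w0.snd⟩
  | i + 1 =>
    let st := run h u p T E M ηc ηs w0 batch i
    { client :=
        if i + 1 ∈ syncSteps T E M then
          fun _ => ∑ n, p n • clientUpdate h u (ηc i) (batch i) st n
        else clientUpdate h u (ηc i) (batch i) st
      server := serverUpdate h u p (ηs i) (batch i) st }

end Algorithm

section Constants

/-- `γ = max {8S/μ - 1, EM}`. -/
def gam (S μ : ℝ) (E M : ℕ) : ℝ := max (8 * S / μ - 1) ((E : ℝ) * M)

/-- The step size `2 / (μ (γ + i))`. -/
def stepSize (S μ : ℝ) (E M : ℕ) (i : ℕ) : ℝ := 2 / (μ * (gam S μ E M + i))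

/-- `Γ = F(w*) - ∑ n, p_n f_n(w*_{c,n}, w*_s)`. -/
def heterogeneityGap {dc ds N : ℕ} {Z A : Type*} [MeasurableSpace Z]
    (h : ServerModel ds → A → ℝ) (u : ClientModel dc → Z → A)
    (P : Fin N → Measure Z) (p : Fin N → ℝ)
    (wStar : Model dc ds) (cStar : Fin N → ClientModel dc) : ℝ :=
  globalLoss h u P p wStar - ∑ n, p n * clientLoss h u (P n) (join (cStar n) wStar.snd)

/-- `H = 6 E M R² + 12 E² M² δ² + 6 S Γ + ∑ n, p_n² σ_n²`. -/
def constH {N : ℕ} (S R δ Γ : ℝ) (E M : ℕ) (p σ : Fin N → ℝ) : ℝ :=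
  6 * E * M * R ^ 2 + 12 * (E : ℝ) ^ 2 * (M : ℝ) ^ 2 * δ ^ 2 + 6 * S * Γ
    + ∑ n, p n ^ 2 * σ n ^ 2

/-- The server-side bound `L_s`; `as` stands for the (expected) squared initial distance
`E ‖w_s^0 - w_s^*‖²`. -/
def serverBound (S μ R : ℝ) (N T E M : ℕ) (as : ℝ) : ℝ :=
  (8 * R ^ 2 + μ ^ 2 * (N : ℝ) ^ 2 * (gam S μ E M + 1) * as)
    / (μ ^ 2 * (N : ℝ) ^ 2 * (gam S μ E M + T * E * M))

/-- The client-side bound `L_c`; `ac` stands for `E ‖w_c^0 - w_c^*‖²`. -/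
def clientBound (S μ H : ℝ) (T E M : ℕ) (ac : ℝ) : ℝ :=
  (4 * H + μ ^ 2 * (gam S μ E M + 1) * ac) / (μ ^ 2 * (gam S μ E M + T * E * M))

/-- The constant of the overall rate `C / (γ + TEM)`; it does not involve `T`. -/
def rateConst (S μ R H : ℝ) (N E M : ℕ) (as ac : ℝ) : ℝ :=
  S / 2 * (8 * R ^ 2 / (μ ^ 2 * (N : ℝ) ^ 2) + 4 * H / μ ^ 2
    + (gam S μ E M + 1) * (as + ac))

end Constants

end MiniBatchSFL

end

open MiniBatchSFL

namespace MiniBatchSFL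

/-! Server and client parts are analysed jointly. Let `x n = [w_{c,n}; w_s]` be the local models and
`w̄ = ∑ n, p n • x n`. Since both sides use the same step size and the weights sum to one, every
step, aggregating or not, moves `w̄` by `-η ∑ n, p n • ∇f(x n; ζ_n)` (`sum_smul_localStep`). The
algorithm is thus local SGD on the full model, with local models that differ only in their client
parts.

Let `Q i` be the mean squared distance of `w̄` to `w*`, `D i` the expected weighted variance of the
client parts, and `K = E * M`. Two recursions carry the proof. Smoothness and strong convexity make
the averaged gradient step contract `Q` by `1 - η μ`, at the price of `2/5 * D` for evaluating
gradients away from `w̄` (`descent_of_scattered_gradients`); the independent noises of the clients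
add `η² ∑ p_n² σ_n²`. Between aggregations `D` grows by a factor `1 + 1/K` plus terms of order `η²`,
because a client step along `∇F` with frozen server part is nonexpansive, so only the divergence `δ`
and the sampling noise spread the clients (`client_dispersion_step`). Aggregation resets `D` to
zero.

Over one round the factors multiply to at most `e`, hence `D = O(η²)`, and `Q` obeys the usual
recursion with an `O(1/i)` solution (`rate_of_recursion`). Smoothness at the minimizer turns `Q`
into the gap of `F`. The terms `8R²/(μ²N²)` and `6SΓ` of the stated bound are nonnegative slack,
added at the end.

Gradients enter the convex analysis only through the two inequalities of `QuadraticBounds`, so no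
differentiation under the expectation is needed. Passing from frozen local models to the random ones
uses that they depend on the past alone and are independent of the fresh mini-batches
(`integral_le_of_indepFun`, `indepFun_localModel_batch`). -/

/-- Young's inequality for squared norms. -/
lemma norm_add_sq_le_young {H : Type*} [NormedAddCommGroup H] (a b : H) {t : ℝ} (ht : 0 < t) :
    ‖a + b‖ ^ 2 ≤ (1 + 1 / t) * ‖a‖ ^ 2 + (1 + t) * ‖b‖ ^ 2 := by
  have h1 := norm_add_le a b
  have h2 : ‖a + b‖ ^ 2 ≤ (‖a‖ + ‖b‖) ^ 2 := by gcongr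
  have h3 : 0 ≤ (‖a‖ - t * ‖b‖) ^ 2 / t := by positivity
  have h4 : (‖a‖ - t * ‖b‖) ^ 2 / t = 1 / t * ‖a‖ ^ 2 - 2 * ‖a‖ * ‖b‖ + t * ‖b‖ ^ 2 := by
    field_simp
    ring
  nlinarith

/-! ### Weighted means and variances in an inner product space. -/

section Weighted

variable {H : Type*} [NormedAddCommGroup H] [InnerProductSpace ℝ H] {N : ℕ}

/-- The weighted second moment about `b` splits into the weighted variance and the squared
distance from the weighted mean to `b`. -/
lemma sum_weight_norm_sub_sq (p : Fin N → ℝ) (hp : ∑ n, p n = 1) (a : Fin N → H) (b : H) :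
    ∑ n, p n * ‖a n - b‖ ^ 2
      = ∑ n, p n * ‖a n - ∑ m, p m • a m‖ ^ 2 + ‖∑ m, p m • a m - b‖ ^ 2 := by
  set c := ∑ m, p m • a m with hc
  have h0 : ∑ n, p n * inner ℝ (a n - c) (c - b) = 0 := by
    have : ∑ n, p n • (a n - c) = 0 := by
      simp [smul_sub, Finset.sum_sub_distrib, ← Finset.sum_smul, hp, ← hc]
    calc ∑ n, p n * inner ℝ (a n - c) (c - b) = inner ℝ (∑ n, p n • (a n - c)) (c - b) := by
          simp [sum_inner, real_inner_smul_left]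
      _ = 0 := by rw [this, inner_zero_left]
  have h1 : ∀ n, p n * ‖a n - b‖ ^ 2 = p n * ‖a n - c‖ ^ 2
      + 2 * (p n * inner ℝ (a n - c) (c - b)) + p n * ‖c - b‖ ^ 2 := by
    intro n
    have : a n - b = (a n - c) + (c - b) := by abel
    rw [this, norm_add_sq_real]; ring
  simp_rw [h1, Finset.sum_add_distrib, ← Finset.mul_sum, h0, ← Finset.sum_mul, hp]
  ring

/-- The mean is the best centre. Dispersions can therefore be estimated around any convenient point,
in particular a deterministic one in place of a random mean. -/
lemma sum_weight_norm_sub_mean_sq_le (p : Fin N → ℝ) (hp : ∑ n, p n = 1) (a : Fin N → H)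
    (b : H) :
    ∑ n, p n * ‖a n - ∑ m, p m • a m‖ ^ 2 ≤ ∑ n, p n * ‖a n - b‖ ^ 2 := by
  rw [sum_weight_norm_sub_sq p hp a b]
  linarith [sq_nonneg ‖∑ m, p m • a m - b‖]

lemma norm_weighted_sum_sq_le (p : Fin N → ℝ) (hp0 : ∀ n, 0 ≤ p n) (hp : ∑ n, p n = 1)
    (a : Fin N → H) : ‖∑ n, p n • a n‖ ^ 2 ≤ ∑ n, p n * ‖a n‖ ^ 2 := by
  have h := sum_weight_norm_sub_sq p hp a 0
  simp only [sub_zero] at h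
  rw [h]
  have : 0 ≤ ∑ n, p n * ‖a n - ∑ m, p m • a m‖ ^ 2 :=
    Finset.sum_nonneg fun n _ => mul_nonneg (hp0 n) (sq_nonneg _)
  linarith

end Weighted

/-! ### Smooth strongly convex functions and the averaged gradient step. -/

section Smooth

variable {H : Type*} [NormedAddCommGroup H] [InnerProductSpace ℝ H]

/-- `f` has the quadratic upper bound with constant `S` and the quadratic lower bound with
constant `μ`, both relative to the first-order expansions given by `g`. -/
structure QuadraticBounds (f : H → ℝ) (g : H → H) (S μ : ℝ) : Prop where
  upper : ∀ x y, f y ≤ f x + inner ℝ (g x) (y - x) + S / 2 * ‖y - x‖ ^ 2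
  lower : ∀ x y, f x + inner ℝ (g x) (y - x) + μ / 2 * ‖y - x‖ ^ 2 ≤ f y

namespace QuadraticBounds

variable {f : H → ℝ} {g : H → H} {S μ : ℝ}

lemma lower' (hf : QuadraticBounds f g S μ) (hμ : 0 ≤ μ) (x y : H) :
    f x + inner ℝ (g x) (y - x) ≤ f y := by
  have := hf.lower x y
  have h2 : 0 ≤ μ / 2 * ‖y - x‖ ^ 2 := by positivity
  linarith

lemma le_of_nontrivial [Nontrivial H] (hf : QuadraticBounds f g S μ) : μ ≤ S := by
  obtain ⟨y, hy⟩ := exists_ne (0 : H)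
  have h1 := hf.upper 0 y
  have h2 := hf.lower 0 y
  have h3 : 0 < ‖y - 0‖ ^ 2 := by
    have : 0 < ‖y - 0‖ := by simpa using hy
    positivity
  have : (μ / 2) * ‖y - 0‖ ^ 2 ≤ S / 2 * ‖y - 0‖ ^ 2 := by linarith
  have := le_of_mul_le_mul_right this h3
  linarith

/-- Convexity based at `x` and smoothness based at `y` are compared at the same test point, one
gradient step of length `1/S` from `y` for the function tilted by `g x`. -/
lemma norm_sub_sq_le_aux (hf : QuadraticBounds f g S μ) (hS : 0 < S) (hμ : 0 ≤ μ) (x y : H) :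
    f x + inner ℝ (g x) (y - x) + 1 / (2 * S) * ‖g y - g x‖ ^ 2 ≤ f y := by
  set d := g y - g x with hd
  have h1 := hf.lower' hμ x (y - (1 / S) • d)
  have h2 := hf.upper y (y - (1 / S) • d)
  have e1 : y - (1 / S) • d - y = -((1 / S) • d) := by abel
  have e2 : y - (1 / S) • d - x = (y - x) - (1 / S) • d := by abel
  rw [e1, inner_neg_right, real_inner_smul_right, norm_neg, norm_smul, mul_pow,
    Real.norm_of_nonneg (by positivity)] at h2
  rw [e2, inner_sub_right, real_inner_smul_right] at h1
  have h3 : inner ℝ (g y) d = inner ℝ (g x) d + ‖d‖ ^ 2 := by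
    rw [← real_inner_self_eq_norm_sq, ← inner_add_left, hd]; congr 1; abel
  rw [h3] at h2
  have h4 : S / 2 * ((1 / S) ^ 2 * ‖d‖ ^ 2) = 1 / (2 * S) * ‖d‖ ^ 2 := by field_simp
  have h5 : 1 / S * (inner ℝ (g x) d + ‖d‖ ^ 2)
      = 1 / S * inner ℝ (g x) d + 2 * (1 / (2 * S) * ‖d‖ ^ 2) := by field_simp
  linarith

/-- Cocoercivity of the gradient of a smooth convex function. -/
lemma cocoercive (hf : QuadraticBounds f g S μ) (hS : 0 < S) (hμ : 0 ≤ μ) (x y : H) :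
    ‖g x - g y‖ ^ 2 ≤ S * inner ℝ (g x - g y) (x - y) := by
  have h1 := hf.norm_sub_sq_le_aux hS hμ x y
  have h2 := hf.norm_sub_sq_le_aux hS hμ y x
  rw [norm_sub_rev] at h1
  have h3 : inner ℝ (g x) (y - x) = - inner ℝ (g x) (x - y) := by
    rw [← inner_neg_right]; simp
  rw [inner_sub_left]
  rw [h3] at h1
  have h4 : 1 / S * ‖g x - g y‖ ^ 2 ≤ inner ℝ (g x) (x - y) - inner ℝ (g y) (x - y) := by
    have : 1 / S * ‖g x - g y‖ ^ 2 = 2 * (1 / (2 * S) * ‖g x - g y‖ ^ 2) := by field_simp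
    linarith
  calc _ = S * (1 / S * ‖g x - g y‖ ^ 2) := by field_simp
    _ ≤ _ := by gcongr

lemma norm_sub_le (hf : QuadraticBounds f g S μ) (hS : 0 < S) (hμ : 0 ≤ μ) (x y : H) :
    ‖g x - g y‖ ≤ S * ‖x - y‖ := by
  have h1 := hf.cocoercive hS hμ x y
  have h2 := real_inner_le_norm (g x - g y) (x - y)
  by_contra! h
  have h0 : 0 ≤ S * ‖x - y‖ := by positivity
  nlinarith

lemma norm_sq_le (hf : QuadraticBounds f g S μ) (hS : 0 < S) {xs : H} (hmin : ∀ x, f xs ≤ f x)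
    (x : H) : ‖g x‖ ^ 2 ≤ 2 * S * (f x - f xs) := by
  have h1 := hf.upper x (x - (1 / S) • g x)
  have h2 := hmin (x - (1 / S) • g x)
  have e1 : x - (1 / S) • g x - x = -((1 / S) • g x) := by abel
  rw [e1, inner_neg_right, real_inner_smul_right, norm_neg, norm_smul, mul_pow,
    Real.norm_of_nonneg (by positivity), real_inner_self_eq_norm_sq] at h1
  have h3 : -(1 / S * ‖g x‖ ^ 2) + S / 2 * ((1 / S) ^ 2 * ‖g x‖ ^ 2)
      = - (1 / (2 * S) * ‖g x‖ ^ 2) := by field_simp; ring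
  have h4 : 1 / (2 * S) * ‖g x‖ ^ 2 ≤ f x - f xs := by linarith
  calc ‖g x‖ ^ 2 = 2 * S * (1 / (2 * S) * ‖g x‖ ^ 2) := by field_simp
    _ ≤ _ := by gcongr

lemma sub_min_le (hf : QuadraticBounds f g S μ) (hS : 0 < S) {xs : H} (hmin : ∀ x, f xs ≤ f x)
    (x : H) : f x - f xs ≤ S / 2 * ‖x - xs‖ ^ 2 := by
  -- At the minimizer itself this bound reads `‖g xs‖² ≤ 0`; stationarity follows without knowing
  -- that `g` is a derivative.
  have h1 := hf.norm_sq_le hS hmin xs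
  have h2 : g xs = 0 := by
    have : ‖g xs‖ ^ 2 ≤ 0 := by simpa using h1
    exact norm_eq_zero.1 (pow_eq_zero_iff two_ne_zero |>.1 (le_antisymm this (sq_nonneg _)))
  have h3 := hf.upper xs x
  rw [h2, inner_zero_left] at h3
  linarith

/-- `f` is squeezed at `x` between its tangent and the upper parabola. This supplies the
measurability of `F` along the random output. -/
lemma continuous (hf : QuadraticBounds f g S μ) (hμ : 0 ≤ μ) :
    Continuous f := by
  rw [continuous_iff_continuousAt]
  intro x
  have ht : Continuous fun y => f x + inner ℝ (g x) (y - x) := by fun_prop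
  have ht2 : Continuous fun y => f x + inner ℝ (g x) (y - x) + S / 2 * ‖y - x‖ ^ 2 := by fun_prop
  refine tendsto_of_tendsto_of_tendsto_of_le_of_le (g := fun y => f x + inner ℝ (g x) (y - x))
    (h := fun y => f x + inner ℝ (g x) (y - x) + S / 2 * ‖y - x‖ ^ 2) ?_ ?_
    (fun y => hf.lower' hμ x y) (fun y => hf.upper x y)
  · simpa using ht.tendsto x
  · simpa using ht2.tendsto x

lemma weighted_sum {N : ℕ} {f : Fin N → H → ℝ} {g : Fin N → H → H}
    (hf : ∀ n, QuadraticBounds (f n) (g n) S μ) (p : Fin N → ℝ) (hp0 : ∀ n, 0 ≤ p n)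
    (hp : ∑ n, p n = 1) :
    QuadraticBounds (fun x => ∑ n, p n * f n x) (fun x => ∑ n, p n • g n x) S μ := by
  have key : ∀ (c : ℝ) (x y : H), ∑ n, p n * f n x + inner ℝ (∑ n, p n • g n x) (y - x)
      + c * ‖y - x‖ ^ 2
      = ∑ n, p n * (f n x + inner ℝ (g n x) (y - x) + c * ‖y - x‖ ^ 2) := by
    intro c x y
    simp_rw [mul_add, Finset.sum_add_distrib, sum_inner, real_inner_smul_left, ← Finset.sum_mul, hp,
      one_mul]
  constructor
  · intro x y
    rw [key]
    exact Finset.sum_le_sum fun n _ => mul_le_mul_of_nonneg_left ((hf n).upper x y) (hp0 n)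
  · intro x y
    rw [key]
    exact Finset.sum_le_sum fun n _ => mul_le_mul_of_nonneg_left ((hf n).lower x y) (hp0 n)

end QuadraticBounds

/-- One step with the weighted average of gradients taken at scattered points contracts the
distance of the weighted mean to the minimizer, up to the weighted variance of the points. -/
lemma descent_of_scattered_gradients {N : ℕ} {f : Fin N → H → ℝ} {g : Fin N → H → H} {S μ : ℝ}
    (hf : ∀ n, QuadraticBounds (f n) (g n) S μ) (hS : 0 < S) (hμ : 0 ≤ μ)
    (p : Fin N → ℝ) (hp0 : ∀ n, 0 ≤ p n) (hp : ∑ n, p n = 1)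
    {xs : H} (hmin : ∀ x, ∑ n, p n * f n xs ≤ ∑ n, p n * f n x)
    {η : ℝ} (hη : 0 ≤ η) (hηS : η * S ≤ 2 / 7) (x : Fin N → H) :
    ‖∑ n, p n • x n - xs - η • ∑ n, p n • g n (x n)‖ ^ 2
      ≤ (1 - η * μ) * ‖∑ n, p n • x n - xs‖ ^ 2
        + 2 / 5 * ∑ n, p n * ‖x n - ∑ m, p m • x m‖ ^ 2 := by
  set w := ∑ n, p n • x n with hw
  set D := ∑ n, p n * ‖x n - w‖ ^ 2 with hD
  have hD0 : 0 ≤ D := Finset.sum_nonneg fun n _ => mul_nonneg (hp0 n) (sq_nonneg _)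
  set G := ∑ n, p n • g n (x n) with hG
  set Fw := ∑ n, p n * f n w with hFw
  set Fs := ∑ n, p n * f n xs with hFs
  have hQ := QuadraticBounds.weighted_sum hf p hp0 hp
  have hgap : 0 ≤ Fw - Fs := sub_nonneg.2 (hmin w)
  -- inner product term
  have hin : Fw - Fs - S / 2 * D + μ / 2 * ‖w - xs‖ ^ 2 ≤ inner ℝ G (w - xs) := by
    -- Both inequalities start from the point `x n` where the gradient is taken: smoothness towards
    -- `w`, strong convexity towards `xs`. The slope terms subtract to the direction `w - xs`.
    have h1 : ∀ n, f n w - f n xs - S / 2 * ‖x n - w‖ ^ 2 + μ / 2 * ‖x n - xs‖ ^ 2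
        ≤ inner ℝ (g n (x n)) (w - xs) := by
      intro n
      have a := (hf n).upper (x n) w
      have b := (hf n).lower (x n) xs
      have e : inner ℝ (g n (x n)) (w - xs)
          = inner ℝ (g n (x n)) (w - x n) - inner ℝ (g n (x n)) (xs - x n) := by
        rw [← inner_sub_right]; congr 1; abel
      rw [norm_sub_rev] at a b
      linarith
    have h2 : inner ℝ G (w - xs) = ∑ n, p n * inner ℝ (g n (x n)) (w - xs) := by
      rw [hG, sum_inner]; simp [real_inner_smul_left]
    have h3 : ∑ n, p n * (f n w - f n xs - S / 2 * ‖x n - w‖ ^ 2 + μ / 2 * ‖x n - xs‖ ^ 2)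
        = Fw - Fs - S / 2 * D + μ / 2 * ∑ n, p n * ‖x n - xs‖ ^ 2 := by
      simp_rw [mul_add, mul_sub, Finset.sum_add_distrib, Finset.sum_sub_distrib, hFw, hFs, hD,
        Finset.mul_sum]
      congr 1
      · congr 1
        exact Finset.sum_congr rfl fun n _ => by ring
      · exact Finset.sum_congr rfl fun n _ => by ring
    have h4 : ‖w - xs‖ ^ 2 ≤ ∑ n, p n * ‖x n - xs‖ ^ 2 := by
      rw [sum_weight_norm_sub_sq p hp x xs]; linarith
    have h5 := Finset.sum_le_sum fun n (_ : n ∈ Finset.univ) =>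
      mul_le_mul_of_nonneg_left (h1 n) (hp0 n)
    rw [h3, ← h2] at h5
    have : μ / 2 * ‖w - xs‖ ^ 2 ≤ μ / 2 * ∑ n, p n * ‖x n - xs‖ ^ 2 := by gcongr
    linarith
  -- squared gradient term
  have hsq : ‖G‖ ^ 2 ≤ 7 / 2 * (2 * S * (Fw - Fs)) + 7 / 5 * (S ^ 2 * D) := by
    set A := ∑ n, p n • g n w with hA
    have e : G = A + (G - A) := by abel
    -- With `t = 2/5` the gradient at the mean gets weight `7/2`, exactly what `η * S ≤ 2/7` lets
    -- the gap term `-2η(Fw - Fs)` absorb.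
    have h1 := norm_add_sq_le_young A (G - A) (t := 2 / 5) (by norm_num)
    rw [← e] at h1
    have h2 : ‖A‖ ^ 2 ≤ 2 * S * (Fw - Fs) := hQ.norm_sq_le hS hmin w
    have h3 : ‖G - A‖ ^ 2 ≤ S ^ 2 * D := by
      have e2 : G - A = ∑ n, p n • (g n (x n) - g n w) := by
        simp [hG, hA, smul_sub, Finset.sum_sub_distrib]
      rw [e2]
      refine (norm_weighted_sum_sq_le p hp0 hp _).trans ?_
      rw [hD, Finset.mul_sum]
      refine Finset.sum_le_sum fun n _ => ?_
      have := (hf n).norm_sub_le hS hμ (x n) w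
      calc p n * ‖g n (x n) - g n w‖ ^ 2 ≤ p n * (S * ‖x n - w‖) ^ 2 := by
            have := hp0 n
            gcongr
        _ = _ := by ring
    have : (1 + 1 / (2 / 5 : ℝ)) = 7 / 2 := by norm_num
    rw [this] at h1
    have : (1 + (2 / 5 : ℝ)) = 7 / 5 := by norm_num
    rw [this] at h1
    linarith
  have hexp : ‖w - xs - η • G‖ ^ 2 = ‖w - xs‖ ^ 2 - 2 * η * inner ℝ G (w - xs)
      + η ^ 2 * ‖G‖ ^ 2 := by
    rw [norm_sub_sq_real, real_inner_smul_right, norm_smul, mul_pow, Real.norm_of_nonneg hη,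
      real_inner_comm]
    ring
  rw [hexp]
  have a1 : η * (Fw - Fs - S / 2 * D + μ / 2 * ‖w - xs‖ ^ 2) ≤ η * inner ℝ G (w - xs) := by gcongr
  have a2 : η ^ 2 * ‖G‖ ^ 2 ≤ η ^ 2 * (7 / 2 * (2 * S * (Fw - Fs)) + 7 / 5 * (S ^ 2 * D)) := by
    gcongr
  have a3 : (η * S) * (η * (Fw - Fs)) ≤ 2 / 7 * (η * (Fw - Fs)) :=
    mul_le_mul_of_nonneg_right hηS (mul_nonneg hη hgap)
  have hηS0 : 0 ≤ η * S := by positivity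
  have a4 : (η * S) * D ≤ 2 / 7 * D := mul_le_mul_of_nonneg_right hηS hD0
  have a5 : (η * S) ^ 2 * D ≤ (2 / 7) ^ 2 * D := by gcongr
  -- The gap terms `7(ηS)η(Fw - Fs)` and `-2η(Fw - Fs)` sum to at most zero. The coefficient of `D`
  -- is `ηS + 7/5 (ηS)² ≤ 2/7 + 4/35 = 2/5`.
  nlinarith

end Smooth

/-! ### Spreading of the client models under noiseless local steps. -/

section Drift

variable {dc ds : ℕ}

lemma norm_fst_sq_le (x : Model dc ds) : ‖x.fst‖ ^ 2 ≤ ‖x‖ ^ 2 := by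
  rw [WithLp.prod_norm_sq_eq_of_L2]
  linarith [sq_nonneg ‖x.snd‖]

/-- A gradient step in the client coordinates, with frozen server coordinates, is nonexpansive. -/
lemma QuadraticBounds.client_step_nonexpansive {f : Model dc ds → ℝ}
    {g : Model dc ds → Model dc ds} {S μ : ℝ} (hf : QuadraticBounds f g S μ) (hS : 0 < S)
    (hμ : 0 ≤ μ) {η : ℝ} (hη : 0 ≤ η) (hηS : η * S ≤ 2) {x y : Model dc ds}
    (hxy : x.snd = y.snd) :
    ‖x.fst - y.fst - η • (g x - g y).fst‖ ^ 2 ≤ ‖x.fst - y.fst‖ ^ 2 := by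
  have h1 := hf.cocoercive hS hμ x y
  -- Since the server parts agree, the inner product sees only client coordinates, and cocoercivity
  -- of the full gradient passes to its client block.
  have h2 : inner ℝ (g x - g y) (x - y) = inner ℝ (g x - g y).fst (x.fst - y.fst) := by
    rw [WithLp.prod_inner_apply]
    simp [hxy]
  rw [h2] at h1
  have h3 := (norm_fst_sq_le (g x - g y)).trans h1
  rw [norm_sub_sq_real, real_inner_smul_right, norm_smul, mul_pow, Real.norm_of_nonneg hη,
    real_inner_comm]
  set I := inner ℝ (g x - g y).fst (x.fst - y.fst)
  have hI : 0 ≤ I := by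
    have : 0 ≤ S * I := (sq_nonneg _).trans h3
    exact nonneg_of_mul_nonneg_right this hS
  have h4 : η ^ 2 * ‖(g x - g y).fst‖ ^ 2 ≤ η ^ 2 * (S * I) := by gcongr
  have h5 : (η * S) * (η * I) ≤ 2 * (η * I) := by gcongr
  nlinarith

/-- The dispersion of the client-side models after one noiseless local step. -/
lemma client_dispersion_step {N : ℕ} {f : Fin N → Model dc ds → ℝ}
    {g : Fin N → Model dc ds → Model dc ds} {S μ : ℝ}
    (hf : ∀ n, QuadraticBounds (f n) (g n) S μ) (hS : 0 < S) (hμ : 0 ≤ μ)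
    (p : Fin N → ℝ) (hp0 : ∀ n, 0 ≤ p n) (hp : ∑ n, p n = 1)
    {η : ℝ} (hη : 0 ≤ η) (hηS : η * S ≤ 2) {δ : ℝ} (x : Fin N → Model dc ds)
    (hsnd : ∀ n m, (x n).snd = (x m).snd)
    (hδ : ∀ n, ‖g n (x n) - ∑ m, p m • g m (x n)‖ ^ 2 ≤ δ ^ 2) {t : ℝ} (ht : 0 < t) :
    ∑ n, p n * ‖(x n - η • g n (x n)).fst - ∑ m, p m • (x m - η • g m (x m)).fst‖ ^ 2
      ≤ (1 + 1 / t) * ∑ n, p n * ‖(x n).fst - ∑ m, p m • (x m).fst‖ ^ 2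
        + (1 + t) * (η ^ 2 * δ ^ 2) := by
  set c := ∑ m, p m • (x m).fst with hc
  have hQ := QuadraticBounds.weighted_sum hf p hp0 hp
  set G := fun w => ∑ m, p m • g m w with hG
  have hterm : ∀ n, ‖(x n - η • g n (x n)).fst - (c - η • (G (join c (x n).snd)).fst)‖ ^ 2
      ≤ (1 + 1 / t) * ‖(x n).fst - c‖ ^ 2 + (1 + t) * (η ^ 2 * δ ^ 2) := by
    intro n
    -- The comparison point is the averaged client model moved by a step along `∇F`. The divergence
    -- `g n - G` is evaluated at `x n`, so the bound `δ` is never needed at the averaged model.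
    have e : (x n - η • g n (x n)).fst - (c - η • (G (join c (x n).snd)).fst)
        = ((x n).fst - c - η • (G (x n) - G (join c (x n).snd)).fst)
          + -(η • (g n (x n) - G (x n)).fst) := by
      simp only [WithLp.sub_fst, WithLp.smul_fst, smul_sub]
      abel
    rw [e]
    refine (norm_add_sq_le_young _ _ ht).trans ?_
    have h1 := hQ.client_step_nonexpansive hS hμ hη hηS (x := x n) (y := join c (x n).snd) rfl
    have h2 : ‖(g n (x n) - G (x n)).fst‖ ^ 2 ≤ δ ^ 2 := (norm_fst_sq_le _).trans (hδ n)
    rw [norm_neg, norm_smul, mul_pow, Real.norm_of_nonneg hη]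
    change ‖(x n).fst - c - _‖ ^ 2 ≤ ‖(x n).fst - c‖ ^ 2 at h1
    exact add_le_add (mul_le_mul_of_nonneg_left h1 (by positivity))
      (mul_le_mul_of_nonneg_left (by gcongr) (by positivity))
  rcases Nat.eq_zero_or_pos N with rfl | hN
  · simp at hp
  -- The shared server part makes the moved centre the same for all clients, as required to compare
  -- with the variance about the mean.
  have hcen : ∀ n, join c (x n).snd = join c (x ⟨0, hN⟩).snd := fun n => by rw [hsnd n]
  refine (sum_weight_norm_sub_mean_sq_le p hp (fun n => (x n - η • g n (x n)).fst)
    (c - η • (G (join c (x ⟨0, hN⟩).snd)).fst)).trans ?_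
  calc _ ≤ ∑ n, p n * ((1 + 1 / t) * ‖(x n).fst - c‖ ^ 2 + (1 + t) * (η ^ 2 * δ ^ 2)) := by
        refine Finset.sum_le_sum fun n _ => mul_le_mul_of_nonneg_left ?_ (hp0 n)
        rw [← hcen n]
        exact hterm n
    _ = _ := by
        simp_rw [mul_add, Finset.sum_add_distrib, ← Finset.sum_mul, hp, Finset.mul_sum, one_mul]
        congr 1
        exact Finset.sum_congr rfl fun n _ => by ring

end Drift

/-! ### Second moments of independent centred noise. -/

section Noise

lemma integrable_inner_of_memLp {H Ω : Type*} [NormedAddCommGroup H] [InnerProductSpace ℝ H]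
    [MeasurableSpace Ω] {Pr : Measure Ω} {X Y : Ω → H}
    (hX : MemLp X 2 Pr) (hY : MemLp Y 2 Pr) :
    Integrable (fun ω => (inner ℝ (X ω) (Y ω) : ℝ)) Pr := by
  refine ((hX.integrable_norm_pow two_ne_zero).add (hY.integrable_norm_pow two_ne_zero)).mono'
    (hX.1.inner hY.1) (Filter.Eventually.of_forall fun ω => ?_)
  have h1 := norm_inner_le_norm (𝕜 := ℝ) (X ω) (Y ω)
  simp only [Pi.add_apply]
  nlinarith [sq_nonneg (‖X ω‖ - ‖Y ω‖), sq_nonneg ‖X ω‖, sq_nonneg ‖Y ω‖]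

variable {H : Type*} [NormedAddCommGroup H] [InnerProductSpace ℝ H] [CompleteSpace H]
  {Ω : Type*} [MeasurableSpace Ω]

lemma integral_norm_sub_smul_sq {Pr : Measure Ω} [IsProbabilityMeasure Pr] {e : Ω → H}
    (he : MemLp e 2 Pr) (h0 : ∫ ω, e ω ∂Pr = 0) (a : H) (η : ℝ) :
    Integrable (fun ω => ‖a - η • e ω‖ ^ 2) Pr ∧
      ∫ ω, ‖a - η • e ω‖ ^ 2 ∂Pr = ‖a‖ ^ 2 + η ^ 2 * ∫ ω, ‖e ω‖ ^ 2 ∂Pr := by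
  have hint : Integrable e Pr := he.integrable one_le_two
  have hsq : Integrable (fun ω => ‖e ω‖ ^ 2) Pr := he.integrable_norm_pow two_ne_zero
  have hin : Integrable (fun ω => inner ℝ a (e ω)) Pr := hint.const_inner a
  have hexp : ∀ ω, ‖a - η • e ω‖ ^ 2
      = ‖a‖ ^ 2 - 2 * η * inner ℝ a (e ω) + η ^ 2 * ‖e ω‖ ^ 2 := by
    intro ω
    rw [norm_sub_sq_real, real_inner_smul_right, norm_smul, mul_pow, Real.norm_eq_abs, sq_abs]
    ring
  have i1 : Integrable (fun ω => ‖a‖ ^ 2 - 2 * η * inner ℝ a (e ω)) Pr :=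
    (integrable_const _).sub (hin.const_mul _)
  have i2 := hsq.const_mul (η ^ 2)
  simp_rw [hexp]
  refine ⟨i1.add i2, ?_⟩
  rw [integral_add i1 i2, integral_sub (integrable_const _) (hin.const_mul _),
    integral_const_mul, integral_const_mul, integral_inner hint, h0]
  simp

variable [MeasurableSpace H] [BorelSpace H] [SecondCountableTopology H]

/-- Independence turns the joint law into a product, and Fubini integrates out `Y` first, where
linearity of the inner product gives zero. -/
lemma integral_inner_eq_zero_of_indepFun {Pr : Measure Ω} [IsProbabilityMeasure Pr] {X Y : Ω → H}
    (hX : MemLp X 2 Pr) (hY : MemLp Y 2 Pr) (hXY : IndepFun X Y Pr) (h0 : ∫ ω, Y ω ∂Pr = 0) :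
    ∫ ω, inner ℝ (X ω) (Y ω) ∂Pr = 0 := by
  have hXm := hX.1.aemeasurable
  have hYm := hY.1.aemeasurable
  have hmap := (indepFun_iff_map_prod_eq_prod_map_map hXm hYm).1 hXY
  have hint : Integrable (fun ω => inner ℝ (X ω) (Y ω)) Pr := integrable_inner_of_memLp hX hY
  have hcont : Continuous fun q : H × H => (inner ℝ q.1 q.2 : ℝ) := by fun_prop
  have : IsProbabilityMeasure (Pr.map X) := Measure.isProbabilityMeasure_map hXm
  have : IsProbabilityMeasure (Pr.map Y) := Measure.isProbabilityMeasure_map hYm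
  have e1 : ∫ ω, inner ℝ (X ω) (Y ω) ∂Pr
      = ∫ q, inner ℝ q.1 q.2 ∂((Pr.map X).prod (Pr.map Y)) := by
    rw [← hmap, integral_map (hXm.prodMk hYm) hcont.aestronglyMeasurable]
  have hint2 : Integrable (fun q : H × H => (inner ℝ q.1 q.2 : ℝ))
      ((Pr.map X).prod (Pr.map Y)) := by
    rw [← hmap, integrable_map_measure hcont.aestronglyMeasurable (hXm.prodMk hYm)]
    exact hint
  have hYint : Integrable (fun y : H => y) (Pr.map Y) := by
    exact (integrable_map_measure aestronglyMeasurable_id hYm).2 (hY.integrable one_le_two)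
  have hY0 : ∫ y, y ∂(Pr.map Y) = 0 :=
    (integral_map hYm aestronglyMeasurable_id).trans h0
  rw [e1, integral_prod _ hint2]
  have : ∀ x : H, ∫ y, inner ℝ x y ∂(Pr.map Y) = 0 := by
    intro x
    rw [integral_inner hYint, hY0, inner_zero_right]
  simp [this]

/-- Independent centred noises add up in mean square. -/
lemma integral_norm_sub_weighted_noise_sq {N : ℕ} {Z : Type*} [MeasurableSpace Z]
    (P : Fin N → Measure Z) [∀ n, IsProbabilityMeasure (P n)] {e : Fin N → Z → H}
    (hm : ∀ n, Measurable (e n)) (he : ∀ n, MemLp (e n) 2 (P n))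
    (h0 : ∀ n, ∫ z, e n z ∂(P n) = 0) (p : Fin N → ℝ) (a : H) (η : ℝ) :
    Integrable (fun z : Fin N → Z => ‖a - η • ∑ n, p n • e n (z n)‖ ^ 2) (Measure.pi P) ∧
      ∫ z, ‖a - η • ∑ n, p n • e n (z n)‖ ^ 2 ∂(Measure.pi P)
        = ‖a‖ ^ 2 + η ^ 2 * ∑ n, p n ^ 2 * ∫ z, ‖e n z‖ ^ 2 ∂(P n) := by
  have hev : ∀ n, MeasurePreserving (fun z : Fin N → Z => z n) (Measure.pi P) (P n) :=
    fun n => measurePreserving_eval P n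
  have hL : ∀ n, MemLp (fun z : Fin N → Z => e n (z n)) 2 (Measure.pi P) :=
    fun n => (he n).comp_measurePreserving (hev n)
  have hL' : MemLp (fun z : Fin N → Z => ∑ n, p n • e n (z n)) 2 (Measure.pi P) :=
    memLp_finsetSum _ fun n _ => (hL n).const_smul (p n)
  have h0' : ∀ n, ∫ z, e n (z n) ∂(Measure.pi P) = 0 := by
    intro n
    have := integral_map (μ := Measure.pi P) (φ := fun z : Fin N → Z => z n)
      (measurable_pi_apply n).aemeasurable (f := e n) (hm n).aestronglyMeasurable
    rw [(hev n).map_eq, h0 n] at this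
    exact this.symm
  have hnorm : ∀ n, ∫ z, ‖e n (z n)‖ ^ 2 ∂(Measure.pi P) = ∫ z, ‖e n z‖ ^ 2 ∂(P n) := by
    intro n
    have := integral_map (μ := Measure.pi P) (φ := fun z : Fin N → Z => z n)
      (measurable_pi_apply n).aemeasurable (f := fun z => ‖e n z‖ ^ 2)
      ((hm n).norm.pow_const 2).aestronglyMeasurable
    rw [(hev n).map_eq] at this
    exact this.symm
  have hz : ∫ z, ∑ n, p n • e n (z n) ∂(Measure.pi P) = 0 := by
    have hi : ∀ n ∈ Finset.univ, Integrable (fun z : Fin N → Z => p n • e n (z n))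
        (Measure.pi P) := fun n _ => ((hL n).const_smul (p n)).integrable one_le_two
    rw [integral_finsetSum _ hi]
    simp [integral_smul, h0']
  obtain ⟨h1, h2⟩ := integral_norm_sub_smul_sq hL' hz a η
  refine ⟨h1, ?_⟩
  rw [h2]
  congr 2
  have hindep : iIndepFun (fun n (z : Fin N → Z) => e n (z n)) (Measure.pi P) :=
    iIndepFun_pi fun n => (hm n).aemeasurable
  have hoff : ∀ n m, ∫ z, inner ℝ (e n (z n)) (e m (z m)) ∂(Measure.pi P)
      = if n = m then ∫ z, ‖e n z‖ ^ 2 ∂(P n) else 0 := by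
    intro n m
    split_ifs with hnm
    · subst hnm
      simp_rw [real_inner_self_eq_norm_sq]
      exact hnorm n
    · exact integral_inner_eq_zero_of_indepFun (hL n) (hL m) (hindep.indepFun hnm) (h0' m)
  have hexp : ∀ z : Fin N → Z, ‖∑ n, p n • e n (z n)‖ ^ 2
      = ∑ n, ∑ m, p n * p m * inner ℝ (e n (z n)) (e m (z m)) := by
    intro z
    rw [← real_inner_self_eq_norm_sq, sum_inner]
    refine Finset.sum_congr rfl fun n _ => ?_
    rw [inner_sum]
    refine Finset.sum_congr rfl fun m _ => ?_
    rw [real_inner_smul_left, real_inner_smul_right]; ring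
  have hii : ∀ n m, Integrable (fun z : Fin N → Z =>
      p n * p m * inner ℝ (e n (z n)) (e m (z m))) (Measure.pi P) :=
    fun n m => (integrable_inner_of_memLp (hL n) (hL m)).const_mul _
  simp_rw [hexp]
  rw [integral_finsetSum _ fun n _ => integrable_finsetSum _ fun m _ => hii n m]
  refine Finset.sum_congr rfl fun n _ => ?_
  rw [integral_finsetSum _ fun m _ => hii n m]
  simp_rw [integral_const_mul, hoff]
  simp [sq]

end Noise

/-! ### Fresh samples and their independence of the past. -/

section Independence

variable {Ω : Type*} [MeasurableSpace Ω] {Pr : Measure Ω} [IsProbabilityMeasure Pr]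

/-- Expectations of functions of a state and of an independent fresh sample can be bounded by
averaging over the sample first. -/
lemma integral_le_of_indepFun {𝓧 𝓩 : Type*} [MeasurableSpace 𝓧] [MeasurableSpace 𝓩]
    {X : Ω → 𝓧} {ξ : Ω → 𝓩} {ν : Measure 𝓩} [IsProbabilityMeasure ν] (hX : Measurable X)
    (hξ : Measurable ξ) (hlaw : Pr.map ξ = ν) (hind : IndepFun X ξ Pr) {ψ : 𝓧 × 𝓩 → ℝ}
    (hψ : Measurable ψ) (hψ0 : ∀ q, 0 ≤ ψ q) {a : Ω → ℝ} (ha : Integrable a Pr)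
    (hle : ∀ᵐ ω ∂Pr, Integrable (fun z => ψ (X ω, z)) ν ∧ ∫ z, ψ (X ω, z) ∂ν ≤ a ω) :
    Integrable (fun ω => ψ (X ω, ξ ω)) Pr ∧ ∫ ω, ψ (X ω, ξ ω) ∂Pr ≤ ∫ ω, a ω ∂Pr := by
  have hmap : Pr.map (fun ω => (X ω, ξ ω)) = (Pr.prod ν).map (Prod.map X id) := by
    rw [(indepFun_iff_map_prod_eq_prod_map_map hX.aemeasurable hξ.aemeasurable).1 hind, hlaw]
    rw [← Measure.map_prod_map _ _ hX measurable_id, Measure.map_id]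
  have hm1 : Measurable fun ω => (X ω, ξ ω) := hX.prodMk hξ
  have hm2 : Measurable (Prod.map X (id : 𝓩 → 𝓩)) := hX.prodMap measurable_id
  have hΨm : Measurable fun q : Ω × 𝓩 => ψ (X q.1, q.2) := hψ.comp hm2
  have hb : ∀ᵐ ω ∂Pr, ‖∫ z, ‖ψ (X ω, z)‖ ∂ν‖ ≤ a ω := by
    filter_upwards [hle] with ω hω
    simp_rw [Real.norm_of_nonneg (hψ0 _)]
    rw [Real.norm_of_nonneg (integral_nonneg fun z => hψ0 _)]
    exact hω.2
  -- Nonnegativity of `ψ` makes the bound `a` on its partial integrals also a bound on those of its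
  -- norm, which is what integrability on the product requires.
  have hΨ : Integrable (fun q : Ω × 𝓩 => ψ (X q.1, q.2)) (Pr.prod ν) := by
    rw [integrable_prod_iff hΨm.aestronglyMeasurable]
    refine ⟨hle.mono fun ω hω => hω.1, ha.mono' ?_ hb⟩
    exact hΨm.norm.stronglyMeasurable.integral_prod_right.aestronglyMeasurable
  have hint : Integrable ψ (Pr.map fun ω => (X ω, ξ ω)) := by
    rw [hmap, integrable_map_measure hψ.aestronglyMeasurable hm2.aemeasurable]
    exact hΨ
  refine ⟨(integrable_map_measure hψ.aestronglyMeasurable hm1.aemeasurable).1 hint, ?_⟩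
  have e1 : ∫ ω, ψ (X ω, ξ ω) ∂Pr = ∫ q, ψ (X q.1, q.2) ∂(Pr.prod ν) := by
    rw [← integral_map hm1.aemeasurable hψ.aestronglyMeasurable, hmap,
      integral_map hm2.aemeasurable hψ.aestronglyMeasurable]
    rfl
  rw [e1, integral_prod _ hΨ]
  exact integral_mono_ae hΨ.integral_prod_left ha (hle.mono fun ω hω => hω.2)

lemma indepFun_prodMk_left {α β κ : Type*} [MeasurableSpace α] [MeasurableSpace β]
    [MeasurableSpace κ] {X : Ω → α} {Y : Ω → β} {V : Ω → κ} (hX : Measurable X)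
    (hY : Measurable Y) (hV : Measurable V) (h1 : IndepFun X (fun ω => (Y ω, V ω)) Pr)
    (h2 : IndepFun Y V Pr) : IndepFun (fun ω => (X ω, Y ω)) V Pr := by
  have hXY : IndepFun X Y Pr := h1.comp measurable_id measurable_fst
  have m1 := (indepFun_iff_map_prod_eq_prod_map_map hX.aemeasurable
    (hY.prodMk hV).aemeasurable).1 h1
  have m2 := (indepFun_iff_map_prod_eq_prod_map_map hY.aemeasurable hV.aemeasurable).1 h2
  have m3 := (indepFun_iff_map_prod_eq_prod_map_map hX.aemeasurable hY.aemeasurable).1 hXY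
  have : IsProbabilityMeasure (Pr.map X) := Measure.isProbabilityMeasure_map hX.aemeasurable
  have : IsProbabilityMeasure (Pr.map Y) := Measure.isProbabilityMeasure_map hY.aemeasurable
  have : IsProbabilityMeasure (Pr.map V) := Measure.isProbabilityMeasure_map hV.aemeasurable
  rw [indepFun_iff_map_prod_eq_prod_map_map (hX.prodMk hY).aemeasurable hV.aemeasurable, m3]
  have e : (fun ω => ((X ω, Y ω), V ω))
      = MeasurableEquiv.prodAssoc.symm ∘ fun ω => (X ω, (Y ω, V ω)) := rfl
  rw [e, ← Measure.map_map MeasurableEquiv.prodAssoc.symm.measurable (hX.prodMk (hY.prodMk hV)),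
    m1, m2]
  exact ((measurePreserving_prodAssoc _ _ _).symm _).map_eq

/-- A variable determined by an initial value and finitely many terms of an independent family is
independent of the remaining terms. -/
lemma indepFun_of_measurable_past {α β κ ι Z : Type*} [MeasurableSpace α] [MeasurableSpace β]
    [MeasurableSpace κ] [MeasurableSpace Z] {w : Ω → α} {ζ : ι → Ω → Z}
    (hw : Measurable w) (hζ : ∀ i, Measurable (ζ i)) (hind : iIndepFun ζ Pr)
    (hwζ : IndepFun w (fun ω i => ζ i ω) Pr) (s t : Finset ι) (hst : Disjoint s t)
    {X : Ω → β} {ξ : Ω → κ}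
    (hX : ∀ m : MeasurableSpace Ω, Measurable[m] w → (∀ i ∈ s, Measurable[m] (ζ i)) →
      Measurable[m] X)
    (hξ : ∀ m : MeasurableSpace Ω, (∀ i ∈ t, Measurable[m] (ζ i)) → Measurable[m] ξ) :
    IndepFun X ξ Pr := by
  have hS : Measurable fun ω (i : s) => ζ i ω := measurable_pi_lambda _ fun i => hζ i
  have hT : Measurable fun ω (i : t) => ζ i ω := measurable_pi_lambda _ fun i => hζ i
  have h1 : IndepFun w (fun ω => (fun i : s => ζ i ω, fun i : t => ζ i ω)) Pr := by
    have hm : Measurable fun v : ι → Z => (fun i : s => v i, fun i : t => v i) := by fun_prop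
    exact hwζ.comp measurable_id hm
  have h2 := hind.indepFun_finset s t hst hζ
  have h3 := indepFun_prodMk_left hw hS hT h1 h2
  rw [IndepFun_iff_Indep] at h3 ⊢
  refine indep_of_indep_of_le_left (indep_of_indep_of_le_right h3 ?_) ?_
  · rw [← measurable_iff_comap_le]
    refine hξ _ fun i hi => ?_
    exact (measurable_pi_apply (⟨i, hi⟩ : t)).comp
      (comap_measurable (fun ω (i : t) => ζ i ω))
  -- Because `hX` holds for every σ-algebra on `Ω`, it can be applied to the one generated by `w`
  -- and the past samples; `X` need not be factored explicitly through them.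
  · rw [← measurable_iff_comap_le]
    have hc := measurable_iff_comap_le.2 (le_refl (MeasurableSpace.comap
      (fun ω => (w ω, fun i : s => ζ i ω)) inferInstance))
    refine hX _ (measurable_fst.comp hc) fun i hi => ?_
    exact (measurable_pi_apply (⟨i, hi⟩ : s)).comp (measurable_snd.comp hc)

end Independence

/-! ### Partial gradients as blocks of the full stochastic gradient. -/

section Gradient

variable {dc ds : ℕ} {Z A : Type*} {h : ServerModel ds → A → ℝ} {u : ClientModel dc → Z → A}

/-- The chain rule along `c' ↦ join c' s` identifies the gradient used by a client with the client
block of the full one; `batchGrad_snd` does this for the server. -/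
lemma batchGrad_fst {z : Z} (h_diff : Differentiable ℝ fun w : Model dc ds => batchLoss h u w z)
    (c : ClientModel dc) (s : ServerModel ds) :
    (batchGrad h u (join c s) z).fst = gradient (fun c' => h s (u c' z)) c := by
  have h1 : HasFDerivAt (fun w : Model dc ds => batchLoss h u w z)
      (InnerProductSpace.toDual ℝ _ (batchGrad h u (join c s) z)) (join c s) :=
    (h_diff (join c s)).hasGradientAt.hasFDerivAt
  have h2 : HasFDerivAt (fun c' : ClientModel dc => join c' s)
      ((WithLp.prodContinuousLinearEquiv 2 ℝ (ClientModel dc) (ServerModel ds)).symm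
        |>.toContinuousLinearMap.comp (ContinuousLinearMap.inl ℝ _ _)) c :=
    ((WithLp.prodContinuousLinearEquiv 2 ℝ (ClientModel dc)
      (ServerModel ds)).symm.hasFDerivAt).comp c (hasFDerivAt_prodMk_left c s)
  have h3 := HasFDerivAt.comp c h1 h2
  have e : InnerProductSpace.toDual ℝ _ (batchGrad h u (join c s) z).fst
      = (InnerProductSpace.toDual ℝ _ (batchGrad h u (join c s) z)).comp
        ((WithLp.prodContinuousLinearEquiv 2 ℝ (ClientModel dc) (ServerModel ds)).symm
          |>.toContinuousLinearMap.comp (ContinuousLinearMap.inl ℝ _ _)) := by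
    ext v
    simp [WithLp.prod_inner_apply]
  rw [← e] at h3
  exact (HasGradientAt.gradient (hasGradientAt_iff_hasFDerivAt.2 h3)).symm

lemma batchGrad_snd {z : Z} (h_diff : Differentiable ℝ fun w : Model dc ds => batchLoss h u w z)
    (c : ClientModel dc) (s : ServerModel ds) :
    (batchGrad h u (join c s) z).snd = gradient (fun s' => h s' (u c z)) s := by
  have h1 : HasFDerivAt (fun w : Model dc ds => batchLoss h u w z)
      (InnerProductSpace.toDual ℝ _ (batchGrad h u (join c s) z)) (join c s) :=
    (h_diff (join c s)).hasGradientAt.hasFDerivAt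
  have h2 : HasFDerivAt (fun s' : ServerModel ds => join c s')
      ((WithLp.prodContinuousLinearEquiv 2 ℝ (ClientModel dc) (ServerModel ds)).symm
        |>.toContinuousLinearMap.comp (ContinuousLinearMap.inr ℝ _ _)) s :=
    ((WithLp.prodContinuousLinearEquiv 2 ℝ (ClientModel dc)
      (ServerModel ds)).symm.hasFDerivAt).comp s (hasFDerivAt_prodMk_right c s)
  have h3 := HasFDerivAt.comp s h1 h2
  have e : InnerProductSpace.toDual ℝ _ (batchGrad h u (join c s) z).snd
      = (InnerProductSpace.toDual ℝ _ (batchGrad h u (join c s) z)).comp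
        ((WithLp.prodContinuousLinearEquiv 2 ℝ (ClientModel dc) (ServerModel ds)).symm
          |>.toContinuousLinearMap.comp (ContinuousLinearMap.inr ℝ _ _)) := by
    ext v
    simp [WithLp.prod_inner_apply]
  rw [← e] at h3
  exact (HasGradientAt.gradient (hasGradientAt_iff_hasFDerivAt.2 h3)).symm

end Gradient

/-! ### The algorithm as a recursion on tuples of full local models. -/

section LocalStep

variable {dc ds N : ℕ}

lemma model_ext {x y : Model dc ds} (h1 : x.fst = y.fst) (h2 : x.snd = y.snd) : x = y :=
  (WithLp.ofLp_injective 2) (Prod.ext h1 h2)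

lemma sum_smul_fst (p : Fin N → ℝ) (x : Fin N → Model dc ds) :
    (∑ n, p n • x n).fst = ∑ n, p n • (x n).fst := by
  change WithLp.fstₗ 2 ℝ (ClientModel dc) (ServerModel ds) _ = _
  rw [map_sum]; rfl

lemma sum_smul_snd (p : Fin N → ℝ) (x : Fin N → Model dc ds) :
    (∑ n, p n • x n).snd = ∑ n, p n • (x n).snd := by
  change WithLp.sndₗ 2 ℝ (ClientModel dc) (ServerModel ds) _ = _
  rw [map_sum]; rfl

/-- One step of the algorithm on the tuple `x` of local models, with stochastic gradients `g`. -/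
noncomputable def localStep (p : Fin N → ℝ) (η : ℝ) (sync : Prop) [Decidable sync] (x g : Fin N → Model dc ds)
    (n : Fin N) : Model dc ds :=
  join (if sync then ∑ m, p m • (x m - η • g m).fst else (x n - η • g n).fst)
    ((x n).snd - η • ∑ m, p m • (g m).snd)

/-- The weighted variance of the client-side parts of the local models. -/
noncomputable def clientDispersion (p : Fin N → ℝ) (x : Fin N → Model dc ds) : ℝ :=
  ∑ n, p n * ‖(x n).fst - ∑ m, p m • (x m).fst‖ ^ 2

lemma clientDispersion_nonneg {p : Fin N → ℝ} (hp0 : ∀ n, 0 ≤ p n) (x : Fin N → Model dc ds) :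
    0 ≤ clientDispersion p x :=
  Finset.sum_nonneg fun n _ => mul_nonneg (hp0 n) (sq_nonneg _)

lemma clientDispersion_eq_zero {p : Fin N → ℝ} (hp : ∑ n, p n = 1) {x : Fin N → Model dc ds}
    (hx : ∀ n m, (x n).fst = (x m).fst) : clientDispersion p x = 0 := by
  refine Finset.sum_eq_zero fun n _ => ?_
  have : ∑ m, p m • (x m).fst = (x n).fst := by
    simp_rw [fun m => hx m n, ← Finset.sum_smul, hp, one_smul]
  simp [this]

/-- All local models share the server part, so only client coordinates contribute to the variance of
the full models. -/
lemma sum_norm_sub_mean_sq_eq_clientDispersion {p : Fin N → ℝ} (hp : ∑ n, p n = 1)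
    {x : Fin N → Model dc ds} (hx : ∀ n m, (x n).snd = (x m).snd) :
    ∑ n, p n * ‖x n - ∑ m, p m • x m‖ ^ 2 = clientDispersion p x := by
  refine Finset.sum_congr rfl fun n _ => ?_
  have : ∑ m, p m • (x m).snd = (x n).snd := by
    simp_rw [fun m => hx m n, ← Finset.sum_smul, hp, one_smul]
  rw [WithLp.prod_norm_sq_eq_of_L2, WithLp.sub_fst, WithLp.sub_snd, sum_smul_fst, sum_smul_snd,
    this]
  simp

variable {p : Fin N → ℝ} {η : ℝ} {sync : Prop} [Decidable sync]

/-- Replacing the client models by their weighted mean leaves that mean unchanged, so aggregation is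
invisible to the global model. -/
lemma sum_smul_localStep (hp : ∑ n, p n = 1) (x g : Fin N → Model dc ds) :
    ∑ n, p n • localStep p η sync x g n = ∑ n, p n • x n - η • ∑ n, p n • g n := by
  apply model_ext
  · have e : ∑ m, p m • (x m - η • g m).fst = (∑ n, p n • x n - η • ∑ n, p n • g n).fst := by
      rw [← sum_smul_fst]
      simp [smul_sub, Finset.sum_sub_distrib, Finset.smul_sum, smul_comm η]
    rw [sum_smul_fst, ← e]
    by_cases hs : sync
    · simp only [localStep, hs, if_true, join, WithLp.toLp_fst, ← Finset.sum_smul, hp, one_smul]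
    · simp only [localStep, hs, if_false, join, WithLp.toLp_fst]
  · rw [sum_smul_snd, WithLp.sub_snd, WithLp.smul_snd, sum_smul_snd, sum_smul_snd]
    simp only [localStep, join, WithLp.toLp_snd, smul_sub, Finset.sum_sub_distrib,
      ← Finset.sum_smul, hp, one_smul]

lemma clientDispersion_localStep_of_sync (hp : ∑ n, p n = 1) (hs : sync)
    (x g : Fin N → Model dc ds) : clientDispersion p (localStep p η sync x g) = 0 :=
  clientDispersion_eq_zero hp fun n m => by simp [localStep, hs, join]

lemma clientDispersion_localStep_of_not_sync (hs : ¬ sync) (x g : Fin N → Model dc ds) :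
    clientDispersion p (localStep p η sync x g) = clientDispersion p fun n => x n - η • g n := by
  simp [clientDispersion, localStep, hs, join]

lemma localModel_run_succ {Z A : Type*} {h : ServerModel ds → A → ℝ} {u : ClientModel dc → Z → A}
    (h_diff : ∀ z, Differentiable ℝ fun w : Model dc ds => batchLoss h u w z)
    (hp : ∑ n, p n = 1) (T E M : ℕ) (η : ℕ → ℝ) (w0 : Model dc ds) (batch : ℕ → Fin N → Z)
    (i : ℕ) (n : Fin N) :
    (run h u p T E M η η w0 batch (i + 1)).localModel n
      = localStep p (η i) (i + 1 ∈ syncSteps T E M)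
          (fun m => (run h u p T E M η η w0 batch i).localModel m)
          (fun m => batchGrad h u ((run h u p T E M η η w0 batch i).localModel m) (batch i m)) n := by
  simp only [run, State.localModel, localStep, clientUpdate, serverUpdate, WithLp.sub_fst,
    WithLp.smul_fst, batchGrad_fst (h_diff _), batchGrad_snd (h_diff _), hp, inv_one, one_smul]
  simp only [join]
  congr 2
  split_ifs <;> rfl

lemma globalModel_eq_sum (hp : ∑ n, p n = 1) (st : State N dc ds) :
    st.globalModel p = ∑ n, p n • st.localModel n := by
  apply model_ext
  · rw [sum_smul_fst]; rfl
  · rw [sum_smul_snd]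
    simp [State.globalModel, State.localModel, join, ← Finset.sum_smul, hp]

end LocalStep

/-! ### Measurable dependence of the local models on the samples. -/

section Measurability

variable {dc ds N : ℕ} {p : Fin N → ℝ}

lemma measurable_fst_model : Measurable fun x : Model dc ds => x.fst :=
  Continuous.measurable (by fun_prop)

lemma measurable_snd_model : Measurable fun x : Model dc ds => x.snd :=
  Continuous.measurable (by fun_prop)

lemma measurable_join {α : Type*} [MeasurableSpace α] {c : α → ClientModel dc}
    {s : α → ServerModel ds} (hc : Measurable c) (hs : Measurable s) :
    Measurable fun a => join (c a) (s a) :=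
  (WithLp.measurable_toLp 2 _).comp (hc.prodMk hs)

lemma measurable_clientDispersion {α : Type*} [MeasurableSpace α] {x : α → Fin N → Model dc ds}
    (hx : ∀ n, Measurable fun a => x a n) : Measurable fun a => clientDispersion p (x a) := by
  have h1 : ∀ n, Measurable fun a => (x a n).fst := fun n => measurable_fst_model.comp (hx n)
  unfold clientDispersion
  fun_prop

lemma measurable_localStep {α : Type*} [MeasurableSpace α] {η : ℝ} {sync : Prop} [Decidable sync]
    {x g : α → Fin N → Model dc ds} (hx : ∀ n, Measurable fun a => x a n)
    (hg : ∀ n, Measurable fun a => g a n) (n : Fin N) :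
    Measurable fun a => localStep p η sync (x a) (g a) n := by
  have h1 : ∀ m, Measurable fun a => (x a m).fst := fun m => measurable_fst_model.comp (hx m)
  have h2 : ∀ m, Measurable fun a => (x a m).snd := fun m => measurable_snd_model.comp (hx m)
  have h3 : ∀ m, Measurable fun a => (g a m).fst := fun m => measurable_fst_model.comp (hg m)
  have h4 : ∀ m, Measurable fun a => (g a m).snd := fun m => measurable_snd_model.comp (hg m)
  unfold localStep
  simp only [WithLp.sub_fst, WithLp.smul_fst]
  refine measurable_join ?_ (by fun_prop)
  split_ifs <;> fun_prop

/-- The local models after `i` steps depend measurably on the initial model and on the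
mini-batches of the first `i` steps. -/
lemma measurable_localModel_run {Z A α : Type*} [MeasurableSpace Z] {_ : MeasurableSpace α}
    {h : ServerModel ds → A → ℝ} {u : ClientModel dc → Z → A}
    (h_diff : ∀ z, Differentiable ℝ fun w : Model dc ds => batchLoss h u w z)
    (h_meas : Measurable fun q : Model dc ds × Z => batchGrad h u q.1 q.2)
    (hp : ∑ n, p n = 1) (T E M : ℕ) (η : ℕ → ℝ) {w0 : α → Model dc ds} (hw0 : Measurable w0)
    {batch : α → ℕ → Fin N → Z} {i : ℕ}
    (hbatch : ∀ j < i, ∀ n, Measurable fun a => batch a j n) (n : Fin N) :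
    Measurable fun a => (run h u p T E M η η (w0 a) (batch a) i).localModel n := by
  induction i generalizing n with
  | zero => exact hw0
  | succ i ih =>
    simp_rw [localModel_run_succ h_diff hp]
    have hx := fun m => ih (fun j hj => hbatch j (hj.trans i.lt_succ_self)) m
    refine measurable_localStep hx (fun m => ?_) n
    exact h_meas.comp ((hx m).prodMk (hbatch i i.lt_succ_self m))

end Measurability

/-! ### One stochastic step from fixed local models. -/

section OneStep

variable {dc ds N : ℕ} {Z A : Type*} [MeasurableSpace Z]
  {h : ServerModel ds → A → ℝ} {u : ClientModel dc → Z → A}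

lemma memLp_batchGrad {P : Measure Z}
    (h_meas : Measurable fun q : Model dc ds × Z => batchGrad h u q.1 q.2) {w : Model dc ds}
    (hw : Integrable (fun z => ‖batchGrad h u w z‖ ^ 2) P) :
    MemLp (fun z => batchGrad h u w z) 2 P :=
  (memLp_two_iff_integrable_sq_norm
    (h_meas.comp measurable_prodMk_left).aestronglyMeasurable).2 hw

lemma integral_batchGrad_sub_clientGrad {P : Measure Z} [IsProbabilityMeasure P]
    {w : Model dc ds} (hw : Integrable (fun z => batchGrad h u w z) P) :
    ∫ z, (batchGrad h u w z - clientGrad h u P w) ∂P = 0 := by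
  rw [integral_sub hw (integrable_const _), clientGrad]
  simp

lemma integral_norm_batchGrad_sub_sq_le {P : Measure Z} [IsProbabilityMeasure P]
    (h_meas : Measurable fun q : Model dc ds × Z => batchGrad h u q.1 q.2) {w : Model dc ds}
    (hw : Integrable (fun z => ‖batchGrad h u w z‖ ^ 2) P) :
    ∫ z, ‖batchGrad h u w z - clientGrad h u P w‖ ^ 2 ∂P ≤ ∫ z, ‖batchGrad h u w z‖ ^ 2 ∂P := by
  have hL := memLp_batchGrad h_meas hw
  -- The choice `a = ∇f_n(w)`, `η = -1` makes `a - η • e` the stochastic gradient, so the identity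
  -- is the bias-variance decomposition.
  have h1 := (integral_norm_sub_smul_sq (hL.sub (memLp_const (clientGrad h u P w)))
    (integral_batchGrad_sub_clientGrad (hL.integrable one_le_two)) (clientGrad h u P w) (-1)).2
  simp only [Pi.sub_apply, neg_smul, one_smul, sub_neg_eq_add, add_sub_cancel] at h1
  rw [h1]
  nlinarith [sq_nonneg ‖clientGrad h u P w‖]

variable {P : Fin N → Measure Z} [∀ n, IsProbabilityMeasure (P n)] {p : Fin N → ℝ} {S μ : ℝ}

/-- Mean squared distance of the global model to the minimizer after a step from fixed local
models. -/
lemma integral_dist_sq_step_le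
    (h_meas : Measurable fun q : Model dc ds × Z => batchGrad h u q.1 q.2)
    (hf : ∀ n, QuadraticBounds (clientLoss h u (P n)) (clientGrad h u (P n)) S μ) (hS : 0 < S)
    (hμ : 0 ≤ μ) (hp0 : ∀ n, 0 ≤ p n) (hp : ∑ n, p n = 1) {wStar : Model dc ds}
    (h_min : ∀ w, globalLoss h u P p wStar ≤ globalLoss h u P p w)
    {η : ℝ} (hη : 0 ≤ η) (hηS : η * S ≤ 2 / 7) {σ : Fin N → ℝ} {x : Fin N → Model dc ds}
    (hsnd : ∀ n m, (x n).snd = (x m).snd)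
    (hx : ∀ n, Integrable (fun z => ‖batchGrad h u (x n) z‖ ^ 2) (P n))
    (hσ : ∀ n, ∫ z, ‖batchGrad h u (x n) z - clientGrad h u (P n) (x n)‖ ^ 2 ∂(P n) ≤ σ n ^ 2) :
    Integrable (fun z : Fin N → Z => ‖∑ n, p n • x n - η • ∑ n, p n • batchGrad h u (x n) (z n)
        - wStar‖ ^ 2) (Measure.pi P) ∧
      ∫ z, ‖∑ n, p n • x n - η • ∑ n, p n • batchGrad h u (x n) (z n) - wStar‖ ^ 2
          ∂(Measure.pi P)
        ≤ (1 - η * μ) * ‖∑ n, p n • x n - wStar‖ ^ 2 + 2 / 5 * clientDispersion p x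
          + η ^ 2 * ∑ n, p n ^ 2 * σ n ^ 2 := by
  have hL := fun n => memLp_batchGrad h_meas (hx n)
  have hdet := descent_of_scattered_gradients hf hS hμ p hp0 hp h_min hη hηS x
  rw [sum_norm_sub_mean_sq_eq_clientDispersion hp hsnd] at hdet
  obtain ⟨h1, h2⟩ := integral_norm_sub_weighted_noise_sq P
    (e := fun n z => batchGrad h u (x n) z - clientGrad h u (P n) (x n))
    (fun n => (h_meas.comp measurable_prodMk_left).sub_const _)
    (fun n => (hL n).sub (memLp_const _))
    (fun n => integral_batchGrad_sub_clientGrad ((hL n).integrable one_le_two)) p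
    (∑ n, p n • x n - wStar - η • ∑ n, p n • clientGrad h u (P n) (x n)) η
  have e : ∀ z : Fin N → Z, ∑ n, p n • x n - wStar - η • ∑ n, p n • clientGrad h u (P n) (x n)
      - η • ∑ n, p n • (batchGrad h u (x n) (z n) - clientGrad h u (P n) (x n))
      = ∑ n, p n • x n - η • ∑ n, p n • batchGrad h u (x n) (z n) - wStar := by
    intro z
    simp only [smul_sub, Finset.sum_sub_distrib]
    abel
  simp_rw [e] at h1 h2
  refine ⟨h1, ?_⟩
  rw [h2]
  refine add_le_add hdet ?_
  gcongr with n
  exact hσ n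

/-- Mean client dispersion after a local step from fixed local models. -/
lemma integral_clientDispersion_step_le
    (h_meas : Measurable fun q : Model dc ds × Z => batchGrad h u q.1 q.2)
    (hf : ∀ n, QuadraticBounds (clientLoss h u (P n)) (clientGrad h u (P n)) S μ) (hS : 0 < S)
    (hμ : 0 ≤ μ) (hp0 : ∀ n, 0 ≤ p n) (hp : ∑ n, p n = 1)
    {η : ℝ} (hη : 0 ≤ η) (hηS : η * S ≤ 2) {R δ : ℝ} {x : Fin N → Model dc ds}
    (hsnd : ∀ n m, (x n).snd = (x m).snd)
    (hx : ∀ n, Integrable (fun z => ‖batchGrad h u (x n) z‖ ^ 2) (P n))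
    (hR : ∀ n, ∫ z, ‖batchGrad h u (x n) z‖ ^ 2 ∂(P n) ≤ R ^ 2)
    (hδ : ∀ n, ‖clientGrad h u (P n) (x n) - globalGrad h u P p (x n)‖ ^ 2 ≤ δ ^ 2)
    {t : ℝ} (ht : 0 < t) :
    Integrable (fun z : Fin N → Z =>
        clientDispersion p fun n => x n - η • batchGrad h u (x n) (z n)) (Measure.pi P) ∧
      ∫ z, clientDispersion p (fun n => x n - η • batchGrad h u (x n) (z n)) ∂(Measure.pi P)
        ≤ (1 + 1 / t) * clientDispersion p x + (1 + t) * (η ^ 2 * δ ^ 2) + η ^ 2 * R ^ 2 := by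
  have hL := fun n => memLp_batchGrad h_meas (hx n)
  have hdet := client_dispersion_step hf hS hμ p hp0 hp hη hηS x hsnd hδ ht
  set b := ∑ m, p m • (x m - η • clientGrad h u (P m) (x m)).fst with hb
  let e := fun n z => (batchGrad h u (x n) z - clientGrad h u (P n) (x n)).fst
  have hem : ∀ n, Measurable (e n) := fun n =>
    measurable_fst_model.comp ((h_meas.comp measurable_prodMk_left).sub_const _)
  have hLe : ∀ n, MemLp (fun z => batchGrad h u (x n) z - clientGrad h u (P n) (x n)) 2 (P n) :=
    fun n => (hL n).sub (memLp_const _)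
  have heL : ∀ n, MemLp (e n) 2 (P n) := fun n =>
    (hLe n).mono (hem n).aestronglyMeasurable
      (Filter.Eventually.of_forall fun z => WithLp.norm_fst_le _ _)
  have he0 : ∀ n, ∫ z, e n z ∂(P n) = 0 := by
    intro n
    have h1 := (WithLp.fstL 2 ℝ (ClientModel dc) (ServerModel ds)).integral_comp_comm
      ((hLe n).integrable one_le_two)
    rw [integral_batchGrad_sub_clientGrad ((hL n).integrable one_le_two), map_zero] at h1
    exact h1
  have heR : ∀ n, ∫ z, ‖e n z‖ ^ 2 ∂(P n) ≤ R ^ 2 := by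
    intro n
    refine (integral_mono ((heL n).integrable_norm_pow two_ne_zero)
      ((hLe n).integrable_norm_pow two_ne_zero) fun z => norm_fst_sq_le _).trans ?_
    exact (integral_norm_batchGrad_sub_sq_le h_meas (hx n)).trans (hR n)
  let y := fun n => (x n - η • clientGrad h u (P n) (x n)).fst - b
  have hone := fun n => integral_norm_sub_smul_sq (heL n) (he0 n) (y n) η
  have hev : ∀ n, MeasurePreserving (fun z : Fin N → Z => z n) (Measure.pi P) (P n) :=
    fun n => measurePreserving_eval P n
  have hmeas1 : ∀ n, Measurable fun z => ‖y n - η • e n z‖ ^ 2 := fun n => by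
    have := hem n
    fun_prop
  have hint : ∀ n, Integrable (fun z : Fin N → Z => p n * ‖y n - η • e n (z n)‖ ^ 2)
      (Measure.pi P) := fun n =>
    (((hev n).integrable_comp (hmeas1 n).aestronglyMeasurable).2 (hone n).1).const_mul _
  have hval : ∀ n, ∫ z : Fin N → Z, ‖y n - η • e n (z n)‖ ^ 2 ∂(Measure.pi P)
      = ∫ z, ‖y n - η • e n z‖ ^ 2 ∂(P n) := by
    intro n
    have := integral_map (μ := Measure.pi P) (φ := fun z : Fin N → Z => z n)
      (measurable_pi_apply n).aemeasurable (hmeas1 n).aestronglyMeasurable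
    rw [(hev n).map_eq] at this
    exact this.symm
  -- Centring at the noiseless mean `b` instead of the random one decouples the clients: each
  -- summand depends on its own mini-batch only.
  have hptw : ∀ z : Fin N → Z, clientDispersion p (fun n => x n - η • batchGrad h u (x n) (z n))
      ≤ ∑ n, p n * ‖y n - η • e n (z n)‖ ^ 2 := by
    intro z
    refine (sum_weight_norm_sub_mean_sq_le p hp
      (fun n => (x n - η • batchGrad h u (x n) (z n)).fst) b).trans_eq ?_
    refine Finset.sum_congr rfl fun n _ => ?_
    congr 3
    simp only [y, e, WithLp.sub_fst, WithLp.smul_fst, smul_sub]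
    abel
  have hGm : ∀ n, Measurable fun z : Fin N → Z => batchGrad h u (x n) (z n) := fun n =>
    (h_meas.comp measurable_prodMk_left).comp (measurable_pi_apply n)
  have hDm : Measurable fun z : Fin N → Z =>
      clientDispersion p fun n => x n - η • batchGrad h u (x n) (z n) :=
    measurable_clientDispersion fun n => by
      have := hGm n
      fun_prop
  have hI : Integrable (fun z : Fin N → Z =>
      clientDispersion p fun n => x n - η • batchGrad h u (x n) (z n)) (Measure.pi P) := by
    refine (integrable_finsetSum Finset.univ fun n _ => hint n).mono' hDm.aestronglyMeasurable
      (Filter.Eventually.of_forall fun z => ?_)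
    rw [Real.norm_of_nonneg (clientDispersion_nonneg hp0 _)]
    simpa using hptw z
  refine ⟨hI, (integral_mono hI (integrable_finsetSum Finset.univ fun n _ => hint n)
    fun z => by simpa using hptw z).trans ?_⟩
  rw [integral_finsetSum _ fun n _ => hint n]
  simp_rw [integral_const_mul, hval, fun n => (hone n).2, mul_add, Finset.sum_add_distrib]
  refine add_le_add hdet ?_
  calc ∑ n, p n * (η ^ 2 * ∫ z, ‖e n z‖ ^ 2 ∂(P n)) ≤ ∑ n, p n * (η ^ 2 * R ^ 2) := by
        gcongr with n
        · exact hp0 n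
        · exact heR n
    _ = η ^ 2 * R ^ 2 := by rw [← Finset.sum_mul, hp, one_mul]

end OneStep

/-! ### Solving the coupled scalar recursions. -/

section Recursion

lemma one_add_one_div_pow_le {K j : ℕ} (hK : 1 ≤ K) (hj : j ≤ K) :
    (1 + 1 / (K : ℝ)) ^ j ≤ 2.72 := by
  have hK' : (0 : ℝ) < K := by exact_mod_cast hK
  calc (1 + 1 / (K : ℝ)) ^ j ≤ (1 + 1 / (K : ℝ)) ^ K :=
        pow_le_pow_right₀ (by simp) hj
    _ ≤ Real.exp (1 / K) ^ K := by
        gcongr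
        linarith [Real.add_one_le_exp (1 / (K : ℝ))]
    _ = Real.exp 1 := by rw [← Real.exp_nat_mul]; congr 1; field_simp
    _ ≤ 2.72 := by linarith [Real.exp_one_lt_d9]

/-- Unrolling gives `D j ≤ (1 + 1/K)^j * (j * b)`: within one period the growth factor stays below
`e < 2.72`, and fewer than `K` increments accumulate. -/
lemma le_of_geometric_growth {D : ℕ → ℝ} {K : ℕ} (hK : 1 ≤ K) {b : ℝ} (hb : 0 ≤ b) (h0 : D 0 ≤ 0)
    (hD : ∀ j, j + 1 < K → D (j + 1) ≤ (1 + 1 / (K : ℝ)) * D j + b) (j : ℕ) (hj : j < K) :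
    D j ≤ 2.72 * (K * b) := by
  have hK' : (0 : ℝ) < K := by exact_mod_cast hK
  have key : ∀ j, j < K → D j ≤ (1 + 1 / (K : ℝ)) ^ j * (j * b) := by
    intro j
    induction j with
    | zero => intro _; simpa using h0
    | succ j ih =>
      intro hj
      have h1 := ih (by omega)
      have h2 := hD j hj
      have h3 : (1 : ℝ) ≤ (1 + 1 / (K : ℝ)) ^ (j + 1) := one_le_pow₀ (by simp)
      calc D (j + 1) ≤ (1 + 1 / (K : ℝ)) * D j + b := h2
        _ ≤ (1 + 1 / (K : ℝ)) * ((1 + 1 / (K : ℝ)) ^ j * (j * b))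
            + (1 + 1 / (K : ℝ)) ^ (j + 1) * b := by
          gcongr
          exact le_mul_of_one_le_left hb h3
        _ = _ := by push_cast; ring
  have hjK : (j : ℝ) ≤ K := by exact_mod_cast hj.le
  refine (key j hj).trans ?_
  gcongr
  exact one_add_one_div_pow_le hK hj.le

/-- The `O(1/i)` rate of the mean squared distance `Q` under step sizes `2 / (μ (γ + i))` when the
dispersion `D` is reset to zero every `K` steps. -/
lemma rate_of_recursion {μ γ R δ B : ℝ} {K T : ℕ} {Q D η : ℕ → ℝ} (hμ : 0 < μ) (hK : 1 ≤ K)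
    (hγK : (K : ℝ) ≤ γ) (hγ : 2 ≤ γ) (hB : 0 ≤ B) (hη : ∀ i, η i = 2 / (μ * (γ + i)))
    (hQ0 : 0 ≤ Q 0) (hD0 : ∀ t < T, D (t * K) = 0)
    (hD : ∀ i, i + 1 < T * K → ¬ K ∣ i + 1 → D (i + 1)
      ≤ (1 + 1 / (K : ℝ)) * D i + (1 + K) * (η i ^ 2 * δ ^ 2) + η i ^ 2 * R ^ 2)
    (hQ : ∀ i < T * K, Q (i + 1) ≤ (1 - η i * μ) * Q i + 2 / 5 * D i + η i ^ 2 * B) :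
    Q (T * K) ≤ (4 * (6 * K * R ^ 2 + 12 * (K : ℝ) ^ 2 * δ ^ 2 + B) / μ ^ 2 + (γ + 1) * Q 0)
      / (γ + (T * K : ℕ)) := by
  have hK1 : (1 : ℝ) ≤ K := by exact_mod_cast hK
  have hη0 : ∀ i, 0 < η i := fun i => by rw [hη]; positivity
  have hDle : ∀ i < T * K, 2 / 5 * D i ≤ η i ^ 2 * (6 * K * R ^ 2 + 12 * (K : ℝ) ^ 2 * δ ^ 2) := by
    intro i hi
    set t := i / K with ht
    set j := i % K with hj
    have hij : t * K + j = i := by rw [mul_comm]; exact Nat.div_add_mod i K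
    have hjK : j < K := Nat.mod_lt _ hK
    have htT : t < T := Nat.div_lt_of_lt_mul (by rwa [mul_comm] at hi)
    have hmono : ∀ k, η (t * K + k) ≤ η (t * K) := by
      intro k
      rw [hη, hη]
      gcongr
      omega
    set b := (1 + K) * (η (t * K) ^ 2 * δ ^ 2) + η (t * K) ^ 2 * R ^ 2 with hb
    have h1 := le_of_geometric_growth (D := fun k => D (t * K + k)) hK (b := b) (by positivity)
      (by simpa using (hD0 t htT).le) (fun k hk => by
        have hlt : t * K + k + 1 < T * K := by
          calc t * K + k + 1 < t * K + K := by omega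
            _ = (t + 1) * K := by ring
            _ ≤ T * K := Nat.mul_le_mul_right _ htT
        have hnd : ¬ K ∣ t * K + k + 1 := by
          intro hd
          rw [add_assoc, Nat.dvd_add_right (Dvd.intro_left t rfl)] at hd
          exact absurd (Nat.le_of_dvd (Nat.succ_pos _) hd) (by omega)
        have h2 := hD (t * K + k) hlt hnd
        have h3 := hmono k
        have h4 : η (t * K + k) ^ 2 ≤ η (t * K) ^ 2 := pow_le_pow_left₀ (hη0 _).le h3 2
        have h5 : (1 + (K : ℝ)) * (η (t * K + k) ^ 2 * δ ^ 2) + η (t * K + k) ^ 2 * R ^ 2 ≤ b := by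
          rw [hb]; gcongr
        rw [add_assoc] at h2
        change D (t * K + (k + 1)) ≤ _
        linarith) j hjK
    simp only [hij] at h1
    -- As `j < K ≤ γ`, the denominators satisfy `γ + tK + j ≤ 2(γ + tK)`: the step size loses at
    -- most a factor two within a round.
    have h2 : η (t * K) ≤ 2 * η i := by
      rw [hη, hη, ← hij, mul_div_assoc', div_le_div_iff₀ (by positivity) (by positivity)]
      have hjr : (j : ℝ) ≤ K := by exact_mod_cast hjK.le
      have : (γ + ((t * K + j : ℕ) : ℝ)) ≤ 2 * (γ + ((t * K : ℕ) : ℝ)) := by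
        push_cast
        have : (0 : ℝ) ≤ t * K := by positivity
        linarith
      nlinarith
    have h3 : η (t * K) ^ 2 ≤ 4 * η i ^ 2 := by
      calc η (t * K) ^ 2 ≤ (2 * η i) ^ 2 := pow_le_pow_left₀ (hη0 _).le h2 2
        _ = _ := by ring
    have h4 : b ≤ (4 * η i ^ 2) * ((1 + K) * δ ^ 2 + R ^ 2) := by
      calc b = η (t * K) ^ 2 * ((1 + K) * δ ^ 2 + R ^ 2) := by rw [hb]; ring
        _ ≤ _ := by gcongr
    have h5 : K * b ≤ K * ((4 * η i ^ 2) * ((1 + K) * δ ^ 2 + R ^ 2)) := by gcongr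
    have h6 : (K : ℝ) * (1 + K) ≤ 2 * (K : ℝ) ^ 2 := by nlinarith
    have h7 : (K : ℝ) * (1 + K) * (η i ^ 2 * δ ^ 2) ≤ 2 * (K : ℝ) ^ 2 * (η i ^ 2 * δ ^ 2) := by
      gcongr
    have h8 : 0 ≤ (K : ℝ) * (η i ^ 2 * R ^ 2) := by positivity
    have h9 : 0 ≤ (K : ℝ) ^ 2 * (η i ^ 2 * δ ^ 2) := by positivity
    -- The constant is `2/5 * 2.72 * 4 = 4.352`, below `6` for the `R²` term; with `K(1 + K) ≤ 2K²`
    -- it is doubled to `8.704`, below `12`, for the `δ²` term.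
    nlinarith
  set C := 6 * K * R ^ 2 + 12 * (K : ℝ) ^ 2 * δ ^ 2 + B with hC
  have hC0 : 0 ≤ C := by positivity
  set v := 4 * C / μ ^ 2 + (γ + 1) * Q 0 with hv
  have hv0 : 0 ≤ v := by positivity
  have hvC : 4 * C / μ ^ 2 ≤ v := by
    have : 0 ≤ (γ + 1) * Q 0 := by positivity
    linarith
  have key : ∀ i ≤ T * K, Q i ≤ v / (γ + i) := by
    intro i
    induction i with
    | zero =>
      intro _
      rw [le_div_iff₀ (by push_cast; linarith)]
      have : 0 ≤ 4 * C / μ ^ 2 := by positivity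
      push_cast
      nlinarith
    | succ i ih =>
      intro hi
      have h1 := ih (by omega)
      have h2 := hQ i (by omega)
      have h3 := hDle i (by omega)
      set s : ℝ := γ + i with hs
      have hs2 : 2 ≤ s := by
        have : (0 : ℝ) ≤ i := by positivity
        linarith
      have e1 : η i * μ = 2 / s := by rw [hη, ← hs]; field_simp
      have e2 : η i ^ 2 * C = (4 * C / μ ^ 2) / s ^ 2 := by rw [hη, ← hs]; field_simp; ring
      -- The contraction factor must be nonnegative before the induction hypothesis can replace `Q
      -- i`; this is the role of `2 ≤ γ`.
      have h4 : 0 ≤ 1 - 2 / s := by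
        rw [sub_nonneg, div_le_one (by linarith)]; exact hs2
      have e3 : γ + ((i + 1 : ℕ) : ℝ) = s + 1 := by push_cast; ring
      rw [e3]
      calc Q (i + 1) ≤ (1 - η i * μ) * Q i + η i ^ 2 * C := by rw [hC]; linarith
        _ = (1 - 2 / s) * Q i + (4 * C / μ ^ 2) / s ^ 2 := by rw [e1, e2]
        _ ≤ (1 - 2 / s) * (v / s) + v / s ^ 2 := by gcongr
        _ = v * ((s - 1) / s ^ 2) := by field_simp; ring
        -- This is `(s - 1)(s + 1) ≤ s²`.
        _ ≤ v * (1 / (s + 1)) := by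
          refine mul_le_mul_of_nonneg_left ?_ hv0
          rw [div_le_div_iff₀ (by positivity) (by linarith)]
          nlinarith
        _ = v / (s + 1) := by ring
  exact key _ le_rfl

end Recursion

/-! ### Joint law of a round of mini-batches and independence of the current models. -/

section Randomness

variable {N : ℕ} {Ω Z : Type*} [MeasurableSpace Ω] [MeasurableSpace Z] {Pr : Measure Ω}
  [IsProbabilityMeasure Pr] {P : Fin N → Measure Z} {ζ : ℕ → Fin N → Ω → Z}

lemma map_batch_eq_pi (hζ_meas : ∀ i n, Measurable (ζ i n))
    (hζ_law : ∀ i n, Measure.map (ζ i n) Pr = P n)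
    (hζ_indep : iIndepFun (fun (q : ℕ × Fin N) ω => ζ q.1 q.2 ω) Pr) (i : ℕ) :
    Pr.map (fun ω n => ζ i n ω) = Measure.pi P := by
  have h1 : iIndepFun (fun (n : Fin N) ω => ζ i n ω) Pr :=
    hζ_indep.precomp (g := fun n : Fin N => (i, n)) fun a b hab => (Prod.ext_iff.1 hab).2
  rw [(iIndepFun_iff_map_fun_eq_pi_map fun n => (hζ_meas i n).aemeasurable).1 h1]
  congr 1
  exact funext fun n => hζ_law i n

lemma indepFun_localModel_batch {dc ds : ℕ} {A : Type*} {h : ServerModel ds → A → ℝ}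
    {u : ClientModel dc → Z → A}
    (h_diff : ∀ z, Differentiable ℝ fun w : Model dc ds => batchLoss h u w z)
    (h_meas : Measurable fun q : Model dc ds × Z => batchGrad h u q.1 q.2)
    {p : Fin N → ℝ} (hp : ∑ n, p n = 1) (T E M : ℕ) (η : ℕ → ℝ)
    (hζ_meas : ∀ i n, Measurable (ζ i n))
    (hζ_indep : iIndepFun (fun (q : ℕ × Fin N) ω => ζ q.1 q.2 ω) Pr)
    {w0 : Ω → Model dc ds} (hw0 : Measurable w0)
    (hw0_indep : IndepFun w0 (fun ω (q : ℕ × Fin N) => ζ q.1 q.2 ω) Pr) (i : ℕ) :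
    IndepFun (fun ω n => (run h u p T E M η η (w0 ω) (fun j n => ζ j n ω) i).localModel n)
      (fun ω n => ζ i n ω) Pr := by
  refine indepFun_of_measurable_past (ζ := fun (q : ℕ × Fin N) ω => ζ q.1 q.2 ω) hw0
    (fun q => hζ_meas q.1 q.2) hζ_indep hw0_indep (Finset.range i ×ˢ Finset.univ)
    ({i} ×ˢ Finset.univ) ?_ (fun m hw hζ => ?_) (fun m hζ => ?_)
  · rw [Finset.disjoint_left]
    rintro ⟨a, b⟩ hab hab'
    simp at hab hab'
    omega
  · exact measurable_pi_iff.2 fun n => measurable_localModel_run h_diff h_meas hp T E M η hw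
      (fun j hj n => hζ (j, n) (by simpa using hj)) n
  · exact measurable_pi_iff.2 fun n => hζ (i, n) (by simp)

end Randomness

/-! ### The two recursions in expectation. -/

section MeanSquareStep

lemma measurable_batchGrad_apply {dc ds N : ℕ} {Z A : Type*} [MeasurableSpace Z]
    {h : ServerModel ds → A → ℝ} {u : ClientModel dc → Z → A}
    (h_meas : Measurable fun q : Model dc ds × Z => batchGrad h u q.1 q.2) (n : Fin N) :
    Measurable fun q : (Fin N → Model dc ds) × (Fin N → Z) =>
      batchGrad h u (q.1 n) (q.2 n) := by
  have hm : Measurable fun q : (Fin N → Model dc ds) × (Fin N → Z) => (q.1 n, q.2 n) := by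
    fun_prop
  exact h_meas.comp hm

variable {dc ds N : ℕ} {Ω Z A : Type*} [MeasurableSpace Ω] [MeasurableSpace Z]
  {h : ServerModel ds → A → ℝ} {u : ClientModel dc → Z → A}
  {P : Fin N → Measure Z} [∀ n, IsProbabilityMeasure (P n)] {p : Fin N → ℝ} {S μ R δ : ℝ}
  {σ : Fin N → ℝ} {Pr : Measure Ω} [IsProbabilityMeasure Pr]
  {X X' : Ω → Fin N → Model dc ds} {ξ : Ω → Fin N → Z} {η : ℝ} {sync : Prop} [Decidable sync]

/-- Mean squared distance of the global model to the minimizer along one step. -/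
lemma expected_dist_sq_step_le
    (h_meas : Measurable fun q : Model dc ds × Z => batchGrad h u q.1 q.2)
    (hf : ∀ n, QuadraticBounds (clientLoss h u (P n)) (clientGrad h u (P n)) S μ) (hS : 0 < S)
    (hμ : 0 ≤ μ) (hp0 : ∀ n, 0 ≤ p n) (hp : ∑ n, p n = 1) {wStar : Model dc ds}
    (h_min : ∀ w, globalLoss h u P p wStar ≤ globalLoss h u P p w)
    (hη : 0 ≤ η) (hηS : η * S ≤ 2 / 7) {W : Set (Model dc ds)}
    (h_var : ∀ n, ∀ w ∈ W,
      ∫ z, ‖batchGrad h u w z - clientGrad h u (P n) w‖ ^ 2 ∂(P n) ≤ σ n ^ 2)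
    (h_moment : ∀ n, ∀ w ∈ W, Integrable (fun z => ‖batchGrad h u w z‖ ^ 2) (P n))
    (hX : Measurable X) (hξ : Measurable ξ) (hlaw : Pr.map ξ = Measure.pi P)
    (hind : IndepFun X ξ Pr) (hsnd : ∀ ω n m, (X ω n).snd = (X ω m).snd)
    (hW : ∀ n, ∀ᵐ ω ∂Pr, X ω n ∈ W)
    (hX' : ∀ ω, X' ω = localStep p η sync (X ω) fun n => batchGrad h u (X ω n) (ξ ω n))
    (hQ : Integrable (fun ω => ‖∑ n, p n • X ω n - wStar‖ ^ 2) Pr)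
    (hD : Integrable (fun ω => clientDispersion p (X ω)) Pr) :
    Integrable (fun ω => ‖∑ n, p n • X' ω n - wStar‖ ^ 2) Pr ∧
      ∫ ω, ‖∑ n, p n • X' ω n - wStar‖ ^ 2 ∂Pr
        ≤ (1 - η * μ) * ∫ ω, ‖∑ n, p n • X ω n - wStar‖ ^ 2 ∂Pr
          + 2 / 5 * ∫ ω, clientDispersion p (X ω) ∂Pr + η ^ 2 * ∑ n, p n ^ 2 * σ n ^ 2 := by
  let ψ : (Fin N → Model dc ds) × (Fin N → Z) → ℝ := fun q =>
    ‖∑ n, p n • q.1 n - η • ∑ n, p n • batchGrad h u (q.1 n) (q.2 n) - wStar‖ ^ 2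
  have hG : ∀ n, Measurable fun q : (Fin N → Model dc ds) × (Fin N → Z) =>
      batchGrad h u (q.1 n) (q.2 n) := measurable_batchGrad_apply h_meas
  have hψ : Measurable ψ := by
    have h1 : Measurable fun q : (Fin N → Model dc ds) × (Fin N → Z) => ∑ n, p n • q.1 n :=
      Finset.measurable_fun_sum _ fun n _ =>
        ((measurable_pi_apply n).comp measurable_fst).const_smul (p n)
    have h2 : Measurable fun q : (Fin N → Model dc ds) × (Fin N → Z) =>
        ∑ n, p n • batchGrad h u (q.1 n) (q.2 n) :=
      Finset.measurable_fun_sum _ fun n _ => (hG n).const_smul (p n)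
    exact (((h1.sub (h2.const_smul η)).sub_const wStar).norm).pow_const 2
  have i1 := hQ.const_mul (1 - η * μ)
  have i2 := hD.const_mul (2 / 5)
  have key := integral_le_of_indepFun hX hξ hlaw hind hψ (fun q => sq_nonneg _)
    ((i1.add i2).add (integrable_const (η ^ 2 * ∑ n, p n ^ 2 * σ n ^ 2))) (by
      filter_upwards [ae_all_iff.2 hW] with ω hω
      exact integral_dist_sq_step_le h_meas hf hS hμ hp0 hp h_min hη hηS (hsnd ω)
        (fun n => h_moment n _ (hω n)) (fun n => h_var n _ (hω n)))
  have e : ∀ ω, ψ (X ω, ξ ω) = ‖∑ n, p n • X' ω n - wStar‖ ^ 2 := by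
    intro ω
    simp only [ψ, hX', sum_smul_localStep hp]
  simp_rw [e] at key
  refine ⟨key.1, key.2.trans_eq ?_⟩
  rw [integral_add' (i1.add i2) (integrable_const _), integral_add' i1 i2, integral_const_mul,
    integral_const_mul]
  simp

/-- Mean client dispersion along one step. -/
lemma expected_clientDispersion_step_le
    (h_meas : Measurable fun q : Model dc ds × Z => batchGrad h u q.1 q.2)
    (hf : ∀ n, QuadraticBounds (clientLoss h u (P n)) (clientGrad h u (P n)) S μ) (hS : 0 < S)
    (hμ : 0 ≤ μ) (hp0 : ∀ n, 0 ≤ p n) (hp : ∑ n, p n = 1)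
    (hη : 0 ≤ η) (hηS : η * S ≤ 2) {W : Set (Model dc ds)}
    (h_moment : ∀ n, ∀ w ∈ W, Integrable (fun z => ‖batchGrad h u w z‖ ^ 2) (P n) ∧
      ∫ z, ‖batchGrad h u w z‖ ^ 2 ∂(P n) ≤ R ^ 2)
    (h_div : ∀ n, ∀ w ∈ W,
      ‖clientGrad h u (P n) w - globalGrad h u P p w‖ ^ 2 ≤ δ ^ 2)
    (hX : Measurable X) (hξ : Measurable ξ) (hlaw : Pr.map ξ = Measure.pi P)
    (hind : IndepFun X ξ Pr) (hsnd : ∀ ω n m, (X ω n).snd = (X ω m).snd)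
    (hW : ∀ n, ∀ᵐ ω ∂Pr, X ω n ∈ W)
    (hX' : ∀ ω, X' ω = localStep p η sync (X ω) fun n => batchGrad h u (X ω n) (ξ ω n))
    (hD : Integrable (fun ω => clientDispersion p (X ω)) Pr) (hs : ¬ sync) {t : ℝ} (ht : 0 < t) :
    Integrable (fun ω => clientDispersion p (X' ω)) Pr ∧
      ∫ ω, clientDispersion p (X' ω) ∂Pr
        ≤ (1 + 1 / t) * ∫ ω, clientDispersion p (X ω) ∂Pr + (1 + t) * (η ^ 2 * δ ^ 2)
          + η ^ 2 * R ^ 2 := by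
  let ψ : (Fin N → Model dc ds) × (Fin N → Z) → ℝ := fun q =>
    clientDispersion p fun n => q.1 n - η • batchGrad h u (q.1 n) (q.2 n)
  have hG : ∀ n, Measurable fun q : (Fin N → Model dc ds) × (Fin N → Z) =>
      batchGrad h u (q.1 n) (q.2 n) := measurable_batchGrad_apply h_meas
  have hψ : Measurable ψ := measurable_clientDispersion fun n =>
    ((measurable_pi_apply n).comp measurable_fst).sub ((hG n).const_smul η)
  have i1 := hD.const_mul (1 + 1 / t)
  have key := integral_le_of_indepFun hX hξ hlaw hind hψ (fun q => clientDispersion_nonneg hp0 _)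
    ((i1.add (integrable_const ((1 + t) * (η ^ 2 * δ ^ 2)))).add
      (integrable_const (η ^ 2 * R ^ 2))) (by
      filter_upwards [ae_all_iff.2 hW] with ω hω
      exact integral_clientDispersion_step_le h_meas hf hS hμ hp0 hp hη hηS (hsnd ω)
        (fun n => (h_moment n _ (hω n)).1) (fun n => (h_moment n _ (hω n)).2)
        (fun n => h_div n _ (hω n)) ht)
  have e : ∀ ω, ψ (X ω, ξ ω) = clientDispersion p (X' ω) := by
    intro ω
    rw [hX', clientDispersion_localStep_of_not_sync hs]
  simp_rw [e] at key
  refine ⟨key.1, key.2.trans_eq ?_⟩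
  rw [integral_add' (i1.add (integrable_const _)) (integrable_const _),
    integral_add' i1 (integrable_const _), integral_const_mul]
  simp

end MeanSquareStep

end MiniBatchSFL

/-! ### Assembly of the convergence bound. -/

theorem theorem1
    {dc ds N : ℕ} {Ω Z A : Type*} [MeasurableSpace Ω] [MeasurableSpace Z]
    -- split loss, laws of the clients' mini-batches, weights of the clients
    (h : ServerModel ds → A → ℝ) (u : ClientModel dc → Z → A)
    (P : Fin N → Measure Z) [∀ n, IsProbabilityMeasure (P n)]
    (p : Fin N → ℝ) (hp_nonneg : ∀ n, 0 ≤ p n) (hp_sum : ∑ n, p n = 1)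
    -- well-definedness of the losses and gradients
    (h_diff : ∀ z : Z, Differentiable ℝ (fun w : Model dc ds => batchLoss h u w z))
    (h_meas : Measurable (fun q : Model dc ds × Z => batchGrad h u q.1 q.2))
    (h_loss_int : ∀ n w, Integrable (fun z => batchLoss h u w z) (P n))
    (h_grad_int : ∀ n w, Integrable (fun z => batchGrad h u w z) (P n))
    -- constants
    (S μ R δ : ℝ) (σ : Fin N → ℝ) (hS : 0 < S) (hμ : 0 < μ)
    (T E M : ℕ) (hT : 1 ≤ T) (hE : 1 ≤ E) (hM : 1 ≤ M)
    -- `S`-smoothness and `μ`-strong convexity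
    (h_smooth : ∀ n, ∀ x y : Model dc ds,
      clientLoss h u (P n) y ≤ clientLoss h u (P n) x
        + inner ℝ (clientGrad h u (P n) x) (y - x) + S / 2 * ‖y - x‖ ^ 2)
    (h_convex : ∀ n, ∀ x y : Model dc ds,
      clientLoss h u (P n) x + inner ℝ (clientGrad h u (P n) x) (y - x)
        + μ / 2 * ‖y - x‖ ^ 2 ≤ clientLoss h u (P n) y)
    -- bounded variance, second moment and gradient divergence on the region `W`
    (W : Set (Model dc ds))
    (h_var : ∀ n, ∀ w ∈ W,
      ∫ z, ‖batchGrad h u w z - clientGrad h u (P n) w‖ ^ 2 ∂(P n) ≤ σ n ^ 2)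
    (h_moment : ∀ n, ∀ w ∈ W, Integrable (fun z => ‖batchGrad h u w z‖ ^ 2) (P n) ∧
      ∫ z, ‖batchGrad h u w z‖ ^ 2 ∂(P n) ≤ R ^ 2)
    (h_div : ∀ n, ∀ w ∈ W,
      ‖clientGrad h u (P n) w - globalGrad h u P p w‖ ^ 2 ≤ δ ^ 2)
    -- minimizers entering `F(w*)` and `Γ`
    (wStar : Model dc ds) (h_min : ∀ w, globalLoss h u P p wStar ≤ globalLoss h u P p w)
    (cStar : Fin N → ClientModel dc)
    (h_cmin : ∀ n c, clientLoss h u (P n) (join (cStar n) wStar.snd)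
      ≤ clientLoss h u (P n) (join c wStar.snd))
    -- randomness: mini-batches and initial model
    (Pr : Measure Ω) [IsProbabilityMeasure Pr]
    (ζ : ℕ → Fin N → Ω → Z) (hζ_meas : ∀ i n, Measurable (ζ i n))
    (hζ_law : ∀ i n, Measure.map (ζ i n) Pr = P n)
    (hζ_indep : iIndepFun (fun (q : ℕ × Fin N) ω => ζ q.1 q.2 ω) Pr)
    (w0 : Ω → Model dc ds) (hw0_meas : Measurable w0) (hw0_L2 : MemLp w0 2 Pr)
    (hw0_indep : IndepFun w0 (fun ω (q : ℕ × Fin N) => ζ q.1 q.2 ω) Pr)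
    -- the states of the algorithm with step sizes `2 / (μ (γ + i))` on both sides
    (st : ℕ → Ω → State N dc ds)
    (h_st : ∀ i ω, st i ω = run h u p T E M (stepSize S μ E M) (stepSize S μ E M)
      (w0 ω) (fun j n => ζ j n ω) i)
    -- the models at which gradients are computed lie in `W`
    (h_W : ∀ i < T * E * M, ∀ n, ∀ᵐ ω ∂Pr, (st i ω).localModel n ∈ W)
    -- the constants of the bounds
    (as ac H : ℝ)
    (h_as : as = ∫ ω, ‖(w0 ω).snd - wStar.snd‖ ^ 2 ∂Pr)
    (h_ac : ac = ∫ ω, ‖(w0 ω).fst - wStar.fst‖ ^ 2 ∂Pr)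
    (h_H : H = constH S R δ (heterogeneityGap h u P p wStar cStar) E M p σ) :
    Integrable (fun ω => globalLoss h u P p ((st (T * E * M) ω).globalModel p)) Pr ∧
    (∫ ω, globalLoss h u P p ((st (T * E * M) ω).globalModel p) ∂Pr) - globalLoss h u P p wStar
      ≤ S * (serverBound S μ R N T E M as + clientBound S μ H T E M ac) / 2 ∧
    S * (serverBound S μ R N T E M as + clientBound S μ H T E M ac) / 2
      = rateConst S μ R H N E M as ac / (gam S μ E M + T * E * M) := by
  have hN : N ≠ 0 := by
    rintro rfl
    simp at hp_sum
  have hf : ∀ n, QuadraticBounds (clientLoss h u (P n)) (clientGrad h u (P n)) S μ :=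
    fun n => ⟨h_smooth n, h_convex n⟩
  have hF : QuadraticBounds (globalLoss h u P p) (globalGrad h u P p) S μ :=
    QuadraticBounds.weighted_sum hf p hp_nonneg hp_sum
  have hEM1 : 1 ≤ E * M := Nat.mul_pos hE hM
  have hγEM : ((E * M : ℕ) : ℝ) ≤ gam S μ E M := by
    push_cast
    exact le_max_right _ _
  have hγ1 : 1 ≤ gam S μ E M := le_trans (by exact_mod_cast hEM1) hγEM
  set γ := gam S μ E M with hγ
  set B := ∑ n, p n ^ 2 * σ n ^ 2 with hB
  have hB0 : 0 ≤ B := Finset.sum_nonneg fun n _ => by positivity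
  set C := 6 * ((E * M : ℕ) : ℝ) * R ^ 2 + 12 * ((E * M : ℕ) : ℝ) ^ 2 * δ ^ 2 + B with hC
  have hC0 : 0 ≤ C := by positivity
  -- the initial distance
  have hd0 : MemLp (fun ω => w0 ω - wStar) 2 Pr := hw0_L2.sub (memLp_const _)
  have hdf : Integrable (fun ω => ‖(w0 ω).fst - wStar.fst‖ ^ 2) Pr := by
    refine (hd0.integrable_norm_pow two_ne_zero).mono'
      (((measurable_fst_model.comp hw0_meas).sub_const _).norm.pow_const 2).aestronglyMeasurable
      (Filter.Eventually.of_forall fun ω => ?_)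
    rw [Real.norm_of_nonneg (sq_nonneg _)]
    exact norm_fst_sq_le (w0 ω - wStar)
  have hQint0 : Integrable (fun ω => ‖w0 ω - wStar‖ ^ 2) Pr := hd0.integrable_norm_pow two_ne_zero
  have hds : Integrable (fun ω => ‖(w0 ω).snd - wStar.snd‖ ^ 2) Pr := by
    have := hQint0.sub hdf
    refine this.congr (Filter.Eventually.of_forall fun ω => ?_)
    simp [WithLp.prod_norm_sq_eq_of_L2]
  have hsum0 : ∫ ω, ‖w0 ω - wStar‖ ^ 2 ∂Pr = as + ac := by
    rw [h_as, h_ac, ← integral_add hds hdf]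
    refine integral_congr_ae (Filter.Eventually.of_forall fun ω => ?_)
    simp [WithLp.prod_norm_sq_eq_of_L2, add_comm]
  have has0 : 0 ≤ as + ac := hsum0 ▸ integral_nonneg fun ω => sq_nonneg _
  -- the local models
  let X : ℕ → Ω → Fin N → Model dc ds := fun i ω n => (st i ω).localModel n
  have hXrun : ∀ i, X i = fun ω n => (run h u p T E M (stepSize S μ E M) (stepSize S μ E M)
      (w0 ω) (fun j n => ζ j n ω) i).localModel n := fun i => by
    funext ω n
    simp only [X, h_st]
  have hXm : ∀ i, Measurable (X i) := fun i => by
    rw [hXrun]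
    exact measurable_pi_iff.2 fun n => measurable_localModel_run h_diff h_meas hp_sum T E M _
      hw0_meas (fun j _ n => hζ_meas j n) n
  have hX0 : ∀ ω n, X 0 ω n = w0 ω := fun ω n => by
    rw [hXrun]
    rfl
  have hmean0 : ∀ ω, ∑ n, p n • X 0 ω n = w0 ω := fun ω => by
    simp_rw [hX0, ← Finset.sum_smul, hp_sum, one_smul]
  have hXs : ∀ i ω, X (i + 1) ω = localStep p (stepSize S μ E M i)
      (i + 1 ∈ syncSteps T E M) (X i ω) fun n => batchGrad h u (X i ω n) (ζ i n ω) := by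
    intro i ω
    funext n
    simp only [hXrun]
    exact localModel_run_succ h_diff hp_sum T E M _ _ _ i n
  have hsnd : ∀ i ω n m, (X i ω n).snd = (X i ω m).snd := fun _ _ _ _ => rfl
  have hglob : ∀ ω, (st (T * E * M) ω).globalModel p = ∑ n, p n • X (T * E * M) ω n :=
    fun ω => globalModel_eq_sum hp_sum _
  -- the mean squared distance of the output to the minimizer
  have hrate : Integrable (fun ω => ‖∑ n, p n • X (T * E * M) ω n - wStar‖ ^ 2) Pr ∧
      ∫ ω, ‖∑ n, p n • X (T * E * M) ω n - wStar‖ ^ 2 ∂Pr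
        ≤ (4 * C / μ ^ 2 + (γ + 1) * (as + ac)) / (γ + T * E * M) := by
    -- For `dc = ds = 0` the two quadratic bounds do not force `μ ≤ S`, but every distance is zero.
    rcases subsingleton_or_nontrivial (Model dc ds) with hsub | hnt
    · have hz : ∀ ω, ‖∑ n, p n • X (T * E * M) ω n - wStar‖ ^ 2 = 0 := fun ω => by
        rw [Subsingleton.elim (∑ n, p n • X (T * E * M) ω n) wStar]
        simp
      simp_rw [hz]
      refine ⟨integrable_zero _ _ _, ?_⟩
      rw [integral_zero]
      positivity
    have hμS : μ ≤ S := hF.le_of_nontrivial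
    -- Since `S/μ ≥ 1`, `8S/μ - 1 ≥ 7S/μ`; this is the source of the step-size bound `η * S ≤ 2/7`.
    have hγS : 7 * (S / μ) ≤ γ := by
      have h1 : 8 * S / μ - 1 ≤ γ := le_max_left _ _
      have h2 : 1 ≤ S / μ := (one_le_div hμ).2 hμS
      have h3 : 8 * S / μ = 8 * (S / μ) := by ring
      linarith
    have hγ2 : 2 ≤ γ := by
      have h2 : 1 ≤ S / μ := (one_le_div hμ).2 hμS
      linarith
    have hη : ∀ i, stepSize S μ E M i = 2 / (μ * (γ + i)) := fun i => rfl
    have hη0 : ∀ i, 0 ≤ stepSize S μ E M i := fun i => by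
      rw [hη]
      positivity
    have hηS : ∀ i, stepSize S μ E M i * S ≤ 2 / 7 := fun i => by
      have h1 : 7 * S ≤ μ * γ := by
        have := mul_le_mul_of_nonneg_left hγS hμ.le
        have e : μ * (7 * (S / μ)) = 7 * S := by field_simp
        linarith
      have h2 : 0 ≤ μ * (i : ℝ) := by positivity
      rw [hη, div_mul_eq_mul_div, div_le_div_iff₀ (by positivity) (by norm_num)]
      nlinarith
    have hEMT : T * E * M = T * (E * M) := mul_assoc _ _ _
    have hξm : ∀ i, Measurable fun ω n => ζ i n ω := fun i =>
      measurable_pi_iff.2 fun n => hζ_meas i n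
    have hlaw := map_batch_eq_pi hζ_meas hζ_law hζ_indep
    have hind : ∀ i, IndepFun (X i) (fun ω n => ζ i n ω) Pr := fun i => by
      rw [hXrun]
      exact indepFun_localModel_batch h_diff h_meas hp_sum T E M _ hζ_meas hζ_indep hw0_meas
        hw0_indep i
    have hDsync : ∀ t ≤ T, ∀ ω, clientDispersion p (X (t * (E * M)) ω) = 0 := by
      intro t htT ω
      rcases Nat.eq_zero_or_pos t with rfl | ht
      · rw [zero_mul]
        exact clientDispersion_eq_zero hp_sum fun n m => by rw [hX0, hX0]
      · obtain ⟨i, hi⟩ : ∃ i, t * (E * M) = i + 1 :=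
          Nat.exists_eq_succ_of_ne_zero (Nat.mul_pos ht hEM1).ne'
        have hs : i + 1 ∈ syncSteps T E M := by
          rw [← hi, syncSteps, Finset.mem_image]
          exact ⟨t, Finset.mem_Icc.2 ⟨ht, htT⟩, mul_assoc _ _ _⟩
        rw [hi, hXs]
        exact clientDispersion_localStep_of_sync hp_sum hs _ _
    have hnsync : ∀ i, ¬ E * M ∣ i + 1 → i + 1 ∉ syncSteps T E M := by
      intro i hi hs
      rw [syncSteps, Finset.mem_image] at hs
      obtain ⟨t, -, ht⟩ := hs
      exact hi ⟨t, by rw [← ht]; ring⟩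
    have hDstep : ∀ i < T * E * M, Integrable (fun ω => clientDispersion p (X i ω)) Pr →
        ¬ E * M ∣ i + 1 →
        Integrable (fun ω => clientDispersion p (X (i + 1) ω)) Pr ∧
        ∫ ω, clientDispersion p (X (i + 1) ω) ∂Pr
          ≤ (1 + 1 / ((E * M : ℕ) : ℝ)) * ∫ ω, clientDispersion p (X i ω) ∂Pr
            + (1 + ((E * M : ℕ) : ℝ)) * (stepSize S μ E M i ^ 2 * δ ^ 2)
            + stepSize S μ E M i ^ 2 * R ^ 2 := fun i hi hD hnd =>
      -- Young's parameter is the round length `E * M`, so that the growth over a round stays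
      -- bounded.
      expected_clientDispersion_step_le h_meas hf hS hμ.le hp_nonneg hp_sum (hη0 i)
        ((hηS i).trans (by norm_num)) h_moment h_div (hXm i) (hξm i) (hlaw i) (hind i) (hsnd i)
        (h_W i hi) (hXs i) hD (hnsync i hnd) (by exact_mod_cast hEM1)
    have hDint : ∀ i ≤ T * E * M, Integrable (fun ω => clientDispersion p (X i ω)) Pr := by
      intro i
      induction i with
      | zero =>
        intro _
        have := hDsync 0 (Nat.zero_le _)
        rw [zero_mul] at this
        simp_rw [this]
        exact integrable_zero _ _ _
      | succ i ih =>
        intro hi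
        by_cases hd : E * M ∣ i + 1
        · obtain ⟨t, ht⟩ := hd
          have htT : t ≤ T := by
            rw [ht, hEMT, mul_comm T] at hi
            exact Nat.le_of_mul_le_mul_left hi hEM1
          have := hDsync t htT
          rw [mul_comm, ← ht] at this
          simp_rw [this]
          exact integrable_zero _ _ _
        · exact (hDstep i hi (ih (Nat.le_of_succ_le hi)) hd).1
    have hQstep : ∀ i < T * E * M, Integrable (fun ω => ‖∑ n, p n • X i ω n - wStar‖ ^ 2) Pr →
        Integrable (fun ω => ‖∑ n, p n • X (i + 1) ω n - wStar‖ ^ 2) Pr ∧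
        ∫ ω, ‖∑ n, p n • X (i + 1) ω n - wStar‖ ^ 2 ∂Pr
          ≤ (1 - stepSize S μ E M i * μ) * ∫ ω, ‖∑ n, p n • X i ω n - wStar‖ ^ 2 ∂Pr
            + 2 / 5 * ∫ ω, clientDispersion p (X i ω) ∂Pr + stepSize S μ E M i ^ 2 * B :=
      fun i hi hQ =>
      expected_dist_sq_step_le h_meas hf hS hμ.le hp_nonneg hp_sum h_min (hη0 i) (hηS i) h_var
        (fun n w hw => (h_moment n w hw).1) (hXm i) (hξm i) (hlaw i) (hind i) (hsnd i) (h_W i hi)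
        (hXs i) hQ (hDint i hi.le)
    have hQint : ∀ i ≤ T * E * M,
        Integrable (fun ω => ‖∑ n, p n • X i ω n - wStar‖ ^ 2) Pr := by
      intro i
      induction i with
      | zero =>
        intro _
        simp_rw [hmean0]
        exact hQint0
      | succ i ih => exact fun hi => (hQstep i hi (ih (Nat.le_of_succ_le hi))).1
    refine ⟨hQint _ le_rfl, ?_⟩
    have key := rate_of_recursion (R := R) (δ := δ) (T := T)
      (Q := fun i => ∫ ω, ‖∑ n, p n • X i ω n - wStar‖ ^ 2 ∂Pr)
      (D := fun i => ∫ ω, clientDispersion p (X i ω) ∂Pr) hμ hEM1 hγEM hγ2 hB0 hη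
      (integral_nonneg fun ω => sq_nonneg _)
      (fun t ht => by simp [hDsync t ht.le])
      (fun i hi hd => (hDstep i (by omega) (hDint i (by omega)) hd).2)
      (fun i hi => (hQstep i (by omega) (hQint i (by omega))).2)
    simp only [hmean0, hsum0, ← hEMT] at key
    rw [hC]
    push_cast at key ⊢
    exact key
  have hgap : ∀ ω, globalLoss h u P p ((st (T * E * M) ω).globalModel p) - globalLoss h u P p wStar
      ≤ S / 2 * ‖∑ n, p n • X (T * E * M) ω n - wStar‖ ^ 2 := fun ω => by
    rw [hglob]
    exact hF.sub_min_le hS h_min _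
  have hFint : Integrable
      (fun ω => globalLoss h u P p ((st (T * E * M) ω).globalModel p) - globalLoss h u P p wStar)
      Pr := by
    refine (hrate.1.const_mul (S / 2)).mono' ?_ (Filter.Eventually.of_forall fun ω => ?_)
    · simp_rw [hglob]
      have hm : Measurable fun ω => ∑ n, p n • X (T * E * M) ω n :=
        Finset.measurable_fun_sum _ fun n _ =>
          ((measurable_pi_apply n).comp (hXm _)).const_smul (p n)
      exact (((hF.continuous hμ.le).measurable.comp hm).sub_const _).aestronglyMeasurable
    · rw [Real.norm_of_nonneg (sub_nonneg.2 (h_min _))]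
      exact hgap ω
  have hFint' : Integrable (fun ω => globalLoss h u P p ((st (T * E * M) ω).globalModel p)) Pr := by
    refine (hFint.add (integrable_const (globalLoss h u P p wStar))).congr
      (Filter.Eventually.of_forall fun ω => ?_)
    simp
  have hγT : 0 < γ + T * E * M := by positivity
  have hN' : (N : ℝ) ≠ 0 := by exact_mod_cast hN
  have heq : S * (serverBound S μ R N T E M as + clientBound S μ H T E M ac) / 2
      = rateConst S μ R H N E M as ac / (gam S μ E M + T * E * M) := by
    rw [serverBound, clientBound, rateConst, ← hγ]
    field_simp
    ring
  refine ⟨hFint', ?_, heq⟩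
  have hΓ : 0 ≤ heterogeneityGap h u P p wStar cStar := by
    rw [heterogeneityGap, globalLoss, ← Finset.sum_sub_distrib]
    refine Finset.sum_nonneg fun n _ => ?_
    rw [← mul_sub]
    -- Minimality of `cStar n` is tested against `wStar.fst`, which turns the joined model into
    -- `wStar`.
    exact mul_nonneg (hp_nonneg n) (sub_nonneg.2 (h_cmin n wStar.fst))
  have hCH : C ≤ H := by
    have h1 : 0 ≤ 6 * S * heterogeneityGap h u P p wStar cStar := by positivity
    rw [h_H, constH, hC]
    push_cast
    linarith
  calc (∫ ω, globalLoss h u P p ((st (T * E * M) ω).globalModel p) ∂Pr) - globalLoss h u P p wStar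
      = ∫ ω, (globalLoss h u P p ((st (T * E * M) ω).globalModel p)
          - globalLoss h u P p wStar) ∂Pr := by
        rw [integral_sub hFint' (integrable_const _)]
        simp
    _ ≤ ∫ ω, S / 2 * ‖∑ n, p n • X (T * E * M) ω n - wStar‖ ^ 2 ∂Pr :=
        integral_mono hFint (hrate.1.const_mul _) hgap
    _ = S / 2 * ∫ ω, ‖∑ n, p n • X (T * E * M) ω n - wStar‖ ^ 2 ∂Pr := integral_const_mul _ _
    _ ≤ S / 2 * ((4 * C / μ ^ 2 + (γ + 1) * (as + ac)) / (γ + T * E * M)) := by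
        gcongr
        exact hrate.2
    -- Here the bound is relaxed to the stated form: the server term is added, and `C ≤ H` holds
    -- because `Γ ≥ 0`.
    _ ≤ S / 2 * ((8 * R ^ 2 / (μ ^ 2 * (N : ℝ) ^ 2) + 4 * H / μ ^ 2 + (γ + 1) * (as + ac))
          / (γ + T * E * M)) := by
        have h1 : 0 ≤ 8 * R ^ 2 / (μ ^ 2 * (N : ℝ) ^ 2) := by positivity
        have h2 : 4 * C / μ ^ 2 ≤ 4 * H / μ ^ 2 := by gcongr
        gcongr
        linarith
    _ = _ := by rw [heq, rateConst, ← hγ, mul_div_assoc (S / 2)]
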